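/- \textbf{Setting.} For $T>0$ let $L^2_\star(0,T)$ be the space of all $u\in L^2(-\infty,T)$ with $u=0$ a.e. in $(-\infty,0)$; for $S\subseteq\mathbb R$ let $L^2_\star(0,T;S)$ be the set of those with $u\in S$ a.e. in $(0,T)$, and $BV_\star(0,T;S)$ the set of those that moreover have finite total variation on $(-\infty,T)$. For $w\in L^2_\star(0,T)$, $Dw\ge 0$ means $-\int_{-\infty}^T w\varphi'\,dt\ge 0$ for all nonnegative $\varphi\in C_c^\infty(-\infty,T)$, and $Dw\ge Dv$ means $D(w-v)\ge 0$. For $r\ge 0$ let $V_r\colon L^2_\star(0,T)\to L^2_\star(0,T)$, $V_r(z)(t)=z(t-r)$. For $N\in\mathbb N$, $N\ge 1$, let $L^2_\star(0,T)_N$ be the space of functions in $L^2_\star(0,T)$ that are constant on each cell $((i-1)\frac TN,i\frac TN)$, $i=1,\dots,N$ (identified with $\mathbb R^N$); for a set $U\subseteq L^2_\star(0,T)$ or $X\subseteq L^2_\star(0,T)^{d+1}$ let $U_N$, $X_N$ be the set of its elements all of whose components are in $L^2_\star(0,T)_N$. For rational $T>0$, $L,l\ge 0$ with $L+l>0$,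 let $U(L,l)$ be the set of all $u\in BV_\star(0,T;\{0,1\})$ such that whenever $u$ switches up (from $0$ to $1$) at time $\tau<T$, it does not switch down in $[\tau,\tau+L)$, and whenever $u$ switches down at $\tau<T$, it does not switch up in $[\tau,\tau+l)$. With $\sigma:=\lceil 2T/(L+l)\rceil$ let \[ U(L,l)^{\mathrm{ext}}:=\big\{(u,z)\colon u\in L^2_\star(0,T;[0,1]),\ z\in L^2_\star(0,T;[0,\sigma]),\ z-V_L(z)\le u,\ z-V_l(z)\le 1-V_l(u)\ \text{a.e. in }(0,T),\ Dz\ge Du,\ Dz\ge 0\big\}. \] \textbf{Theorem.} The set $U(L,l)^{\mathrm{ext}}$ is a small extended formulation of $U(L,l)$ which is weakly compatible with discretization. That is, there are systems of finitely many constraints, one system for each input $(T,L,l)$, each constraint being of the form $F(u,z)\ge 0$ a.e. in $(0,T)$ or $DF(u,z)\ge 0$ with a continuous affine-linear operator $F\colon L^2_\star(0,T)^2\to L^2_\star(0,T)$, such that: \begin{itemize} \item[(i)] For every input, $U(L,l)^{\mathrm{ext}}$ is the solution set of its system, and the projection of $U(L,l)^{\mathrm{ext}}$ to the first coordinate is the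 closure in $L^2_\star(0,T)$ of $\mathrm{conv}(U(L,l))$. \item[(ii)] (Smallness.) The number of controls (which is $2$) and the number of constraints are bounded by a polynomial in the size of the input, i.e. in the total binary length of the numerators and denominators of $T,L,l$. \item[(iii)] (Weak compatibility.) There is a function assigning to every input $(T,L,l)$ and every $M\ge 1$ an integer $\ell\ge 1$, computable in time polynomial in the size of the input and the binary length of $M$, and, for each fixed input, bounded by a polynomial in the value of $M$, such that for $N=\ell M$: the projection of $(U(L,l)^{\mathrm{ext}})_N$ to the first coordinate is $\mathrm{conv}(U(L,l)_N)$; every operator $F$ of the system maps $(L^2_\star(0,T)_N)^2$ to $L^2_\star(0,T)_N$; and the coefficients of the resulting affine-linear maps $\mathbb R^{2N}\to\mathbb R^N$ are rational, each of them being computable in time polynomial in the size of the input and the binary lengths of $N$ and of the indices of the coefficient (so that all of them are computable in time polynomial in the input size and $N$). \end{itemize} Polynomial time refers to random access machines with logarithmic cost. -/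

import Mathlib

open MeasureTheory Set
open scoped ContDiff

noncomputable section

/-! ### Function spaces on `(-∞, T)` -/

/-- Lebesgue measure on `(-∞, T)`. -/
abbrev halfLine (T : ℝ) : Measure ℝ := volume.restrict (Iio T)

/-- `L²_⋆(0,T)`: the elements of `L²(-∞,T)` that vanish a.e. in `(-∞,0)`. -/
def L2star (T : ℝ) : Submodule ℝ (Lp ℝ 2 (halfLine T)) where
  carrier := {u | ∀ᵐ t ∂(halfLine T), t < 0 → u t = 0}
  zero_mem' := by
    filter_upwards [Lp.coeFn_zero ℝ 2 (halfLine T)] with t ht _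
    simpa using ht
  add_mem' := by
    intro u v hu hv
    filter_upwards [hu, hv, Lp.coeFn_add u v] with t h1 h2 h3 h
    rw [h3, Pi.add_apply, h1 h, h2 h, add_zero]
  smul_mem' := by
    intro c u hu
    filter_upwards [hu, Lp.coeFn_smul c u] with t h1 h2 h
    rw [h2, Pi.smul_apply, h1 h, smul_zero]

/-- A representative of an element of `L²_⋆(0,T)`. -/
def rep {T : ℝ} (u : L2star T) : ℝ → ℝ := (u : Lp ℝ 2 (halfLine T))

/-- The values of `u` lie in `S` a.e. in `(0,T)`. -/
def ValuesIn {T : ℝ} (u : L2star T) (S : Set ℝ) : Prop :=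
  ∀ᵐ t ∂(volume.restrict (Ioo 0 T)), rep u t ∈ S

/-- Smooth functions with compact support in `(-∞, T)`. -/
structure IsTestFun (T : ℝ) (φ : ℝ → ℝ) : Prop where
  smooth : ContDiff ℝ ∞ φ
  compact : HasCompactSupport φ
  supp : tsupport φ ⊆ Iio T

/-- The distributional derivative `Du(φ) = -∫ u φ'` on `(-∞,T)`. -/
def distribDeriv {T : ℝ} (u : L2star T) (φ : ℝ → ℝ) : ℝ :=
  -∫ t in Iio T, rep u t * deriv φ t

/-- `Du ≥ 0` in the sense of distributions on `(-∞,T)`. -/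
def DerivNonneg {T : ℝ} (u : L2star T) : Prop :=
  ∀ φ : ℝ → ℝ, IsTestFun T φ → (∀ t, 0 ≤ φ t) → 0 ≤ distribDeriv u φ

/-- The total variation `|u|_{BV(-∞,T)}`. -/
def variation {T : ℝ} (u : L2star T) : ENNReal :=
  ⨆ (φ : ℝ → ℝ) (_ : IsTestFun T φ) (_ : ∀ t, |φ t| ≤ 1),
    ENNReal.ofReal (∫ t in Iio T, rep u t * deriv φ t)

/-- `BV_⋆(0,T;S)`. -/
def BVstar (T : ℝ) (S : Set ℝ) : Set (L2star T) :=
  {u | variation u < ⊤ ∧ ValuesIn u S}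

lemma measurePreserving_shift (T r : ℝ) :
    MeasurePreserving (fun t : ℝ => t - r) (halfLine T) (halfLine (T - r)) := by
  have h := (measurePreserving_sub_right (volume : Measure ℝ) r).restrict_preimage
    (measurableSet_Iio (a := T - r))
  have e : (fun t : ℝ => t - r) ⁻¹' (Iio (T - r)) = Iio T := by
    ext t; simp
  rwa [e] at h

lemma halfLine_mono {T r : ℝ} (hr : 0 ≤ r) : halfLine (T - r) ≤ halfLine T :=
  Measure.restrict_mono (Iio_subset_Iio (by linarith)) le_rfl

lemma memLp_shift {T r : ℝ} (hr : 0 ≤ r) (u : L2star T) :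
    MemLp (fun t => rep u (t - r)) 2 (halfLine T) :=
  ((Lp.memLp (u : Lp ℝ 2 (halfLine T))).mono_measure
    (halfLine_mono hr)).comp_measurePreserving (measurePreserving_shift T r)

lemma ae_shift {T r : ℝ} (hr : 0 ≤ r) {p : ℝ → Prop} (h : ∀ᵐ t ∂(halfLine T), p t) :
    ∀ᵐ t ∂(halfLine T), p (t - r) :=
  (measurePreserving_shift T r).quasiMeasurePreserving.ae (ae_mono (halfLine_mono hr) h)

/-- The right shift `V_r`, `V_r(z)(t) = z(t - r)`, as a continuous linear map on `L²_⋆(0,T)`. -/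
def shift (T r : ℝ) (hr : 0 ≤ r) : L2star T →L[ℝ] L2star T :=
  LinearMap.mkContinuous
    { toFun := fun u => ⟨(memLp_shift hr u).toLp _, by
        filter_upwards [(memLp_shift hr u).coeFn_toLp, ae_shift hr u.2] with t h1 h2 h
        rw [h1]
        exact h2 (by linarith)⟩
      map_add' := by
        intro u v
        ext1
        refine Lp.ext ?_
        filter_upwards [(memLp_shift hr u).coeFn_toLp, (memLp_shift hr v).coeFn_toLp,
          (memLp_shift hr (u + v)).coeFn_toLp,
          ae_shift hr (Lp.coeFn_add (u : Lp ℝ 2 (halfLine T)) v),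
          Lp.coeFn_add ((memLp_shift hr u).toLp _) ((memLp_shift hr v).toLp _)]
          with t h1 h2 h3 h4 h5
        rw [h3]
        refine Eq.trans h4 ?_
        refine Eq.trans ?_ h5.symm
        simp only [Pi.add_apply]
        rw [h1, h2]
        rfl
      map_smul' := by
        intro c u
        ext1
        refine Lp.ext ?_
        filter_upwards [(memLp_shift hr u).coeFn_toLp, (memLp_shift hr (c • u)).coeFn_toLp,
          ae_shift hr (Lp.coeFn_smul c (u : Lp ℝ 2 (halfLine T))),
          Lp.coeFn_smul c ((memLp_shift hr u).toLp _)] with t h1 h3 h4 h5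
        rw [h3]
        refine Eq.trans h4 ?_
        refine Eq.trans ?_ h5.symm
        simp only [Pi.smul_apply]
        rw [h1]
        rfl } 1 (by
    intro u
    rw [one_mul]
    change ‖(memLp_shift hr u).toLp _‖ ≤ ‖(u : Lp ℝ 2 (halfLine T))‖
    rw [Lp.norm_toLp, Lp.norm_def]
    refine ENNReal.toReal_mono (Lp.eLpNorm_ne_top _) ?_
    have h := eLpNorm_comp_measurePreserving (p := 2)
      ((Lp.aestronglyMeasurable (u : Lp ℝ 2 (halfLine T))).mono_measure
        (halfLine_mono (T := T) hr)) (measurePreserving_shift T r)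
    exact h.trans_le (eLpNorm_mono_measure _ (halfLine_mono hr)))

/-! ### Discretization -/

/-- The `i`-th open grid cell (`i = 0, …, N-1`). -/
def gridCell (T : ℝ) (N : ℕ) (i : Fin N) : Set ℝ :=
  Ioo ((i : ℝ) * (T / N)) (((i : ℝ) + 1) * (T / N))

/-- The pointwise representative of the piecewise constant function with values `v`. -/
def stepRep (T : ℝ) (N : ℕ) (v : Fin N → ℝ) (t : ℝ) : ℝ :=
  ∑ i, (gridCell T N i).indicator (fun _ => v i) t

lemma memLp_stepRep (T : ℝ) (N : ℕ) (v : Fin N → ℝ) :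
    MemLp (stepRep T N v) 2 (halfLine T) := by
  unfold stepRep
  refine memLp_finsetSum _ fun i _ => ?_
  refine memLp_indicator_const 2 measurableSet_Ioo (v i) (Or.inr ?_)
  refine ne_top_of_le_ne_top ?_ (Measure.restrict_apply_le _ _)
  simp

lemma stepRep_neg (T : ℝ) (N : ℕ) (v : Fin N → ℝ) (t : ℝ) (ht : t < 0) :
    stepRep T N v t = 0 := by
  refine Finset.sum_eq_zero fun i _ => indicator_of_notMem ?_ _
  rintro ⟨h1, h2⟩
  have hi : (0 : ℝ) ≤ (i : ℝ) := Nat.cast_nonneg _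
  nlinarith

/-- The piecewise constant function `v̄ ∈ L²_⋆(0,T)` of a vector `v ∈ ℝᴺ`. -/
def stepFun (T : ℝ) (N : ℕ) (v : Fin N → ℝ) : L2star T :=
  ⟨(memLp_stepRep T N v).toLp _, by
    filter_upwards [(memLp_stepRep T N v).coeFn_toLp] with t h1 h
    rw [h1, stepRep_neg T N v t h]⟩

/-- `L²_⋆(0,T)_N`. -/
def stepSpace (T : ℝ) (N : ℕ) : Set (L2star T) := range (stepFun T N)

/-- The discretization `U_N` of a set of controls. -/
def discretize {T : ℝ} (N : ℕ) (U : Set (L2star T)) : Set (L2star T) := U ∩ stepSpace T N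

/-- The discretization of a set of tuples of controls. -/
def discretizeTuple {T : ℝ} {d : ℕ} (N : ℕ) (X : Set (Fin (d + 1) → L2star T)) :
    Set (Fin (d + 1) → L2star T) :=
  X ∩ {w | ∀ c, w c ∈ stepSpace T N}

/-! ### Extended formulations -/

/-- The projection to the first coordinate. -/
def projFirst {T : ℝ} {d : ℕ} (X : Set (Fin (d + 1) → L2star T)) : Set (L2star T) :=
  (fun w => w 0) '' X

/-- A constraint `L(u,z₁,…,z_d) ≥ 0` a.e. in `(0,T)` (if `onDeriv = false`)
or `D L(u,z₁,…,z_d) ≥ 0` (if `onDeriv = true`), with `L` continuous and affine-linear. -/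
structure LinConstraint (T : ℝ) (d : ℕ) where
  op : (Fin (d + 1) → L2star T) →ᴬ[ℝ] L2star T
  onDeriv : Bool

def LinConstraint.Holds {T : ℝ} {d : ℕ} (K : LinConstraint T d)
    (w : Fin (d + 1) → L2star T) : Prop :=
  match K.onDeriv with
  | false => ValuesIn (K.op w) (Ici 0)
  | true => DerivNonneg (K.op w)

/-- A finite system of linear constraints in `d + 1` controls. -/
structure LinSystem (T : ℝ) (d : ℕ) where
  m : ℕ
  con : Fin m → LinConstraint T d

def LinSystem.solutions {T : ℝ} {d : ℕ} (A : LinSystem T d) :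
    Set (Fin (d + 1) → L2star T) :=
  {w | ∀ k, (A.con k).Holds w}

/-- `X`, described by the linear system `A`, is an extended formulation of `U`. -/
structure IsExtendedFormulation {T : ℝ} {d : ℕ} (U : Set (L2star T))
    (X : Set (Fin (d + 1) → L2star T)) (A : LinSystem T d) : Prop where
  proj_eq : projFirst X = closure (convexHull ℝ U)
  linear : X = A.solutions

/-- `a` and `b` are the coefficients of the restriction of the operator `F` to the piecewise
constant functions on the grid with `N` cells. -/
def HasCoefficients {T : ℝ} {d : ℕ} (F : (Fin (d + 1) → L2star T) →ᴬ[ℝ] L2star T) (N : ℕ)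
    (a : Fin N → Fin (d + 1) → Fin N → ℝ) (b : Fin N → ℝ) : Prop :=
  ∀ v : Fin (d + 1) → Fin N → ℝ,
    F (fun c => stepFun T N (v c)) = stepFun T N (fun i => (∑ c, ∑ j, a i c j * v c j) + b i)

/-! ### Polynomial time: random access machines with logarithmic cost -/

namespace RAM

/-- Instructions; registers are indexed by `ℕ` and hold integers. -/
inductive Instr where
  | const (a : ℕ) (c : ℤ)
  | copy (a b : ℕ)
  | add (a b c : ℕ)
  | sub (a b c : ℕ)
  | mul (a b c : ℕ)
  | div (a b c : ℕ)
  | load (a b : ℕ)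
  | store (a b : ℕ)
  | jump (n : ℕ)
  | jumpPos (a n : ℕ)

structure State where
  pc : ℕ
  reg : ℕ → ℤ

/-- Assign a value to a register and go to the next instruction. -/
def State.assign (s : State) (a : ℕ) (x : ℤ) : State := ⟨s.pc + 1, Function.update s.reg a x⟩

/-- The effect of an instruction. -/
def Instr.next (s : State) : Instr → State
  | const a c => s.assign a c
  | copy a b => s.assign a (s.reg b)
  | add a b c => s.assign a (s.reg b + s.reg c)
  | sub a b c => s.assign a (s.reg b - s.reg c)
  | mul a b c => s.assign a (s.reg b * s.reg c)
  | div a b c => s.assign a (s.reg b / s.reg c)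
  | load a b => s.assign a (s.reg (s.reg b).toNat)
  | store a b => s.assign (s.reg a).toNat (s.reg b)
  | jump n => ⟨n, s.reg⟩
  | jumpPos a n => if 0 < s.reg a then ⟨n, s.reg⟩ else ⟨s.pc + 1, s.reg⟩

/-- The binary length of an integer. -/
def bits (x : ℤ) : ℕ := x.natAbs.size

/-- The logarithmic cost of an instruction: one plus the binary lengths of all the numbers
involved, including the addresses used in indirect addressing. -/
def Instr.cost (s : State) : Instr → ℕ
  | const _ c => 1 + bits c
  | copy _ b => 1 + bits (s.reg b)
  | add _ b c => 1 + bits (s.reg b) + bits (s.reg c)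
  | sub _ b c => 1 + bits (s.reg b) + bits (s.reg c)
  | mul _ b c => 1 + bits (s.reg b) + bits (s.reg c)
  | div _ b c => 1 + bits (s.reg b) + bits (s.reg c)
  | load _ b => 1 + bits (s.reg b) + bits (s.reg (s.reg b).toNat)
  | store a b => 1 + bits (s.reg a) + bits (s.reg b)
  | jump _ => 1
  | jumpPos a _ => 1 + bits (s.reg a)

/-- `Exec P s k s'`: started in `s`, the program `P` halts in `s'`, at total cost `k`. The
machine halts when the program counter leaves the program. -/
inductive Exec (P : List Instr) : State → ℕ → State → Prop
  | halt (s : State) (h : P[s.pc]? = none) : Exec P s 0 s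
  | step (s : State) (i : Instr) (k : ℕ) (s' : State) (h : P[s.pc]? = some i)
      (h' : Exec P (i.next s) k s') : Exec P s (i.cost s + k) s'

/-- The initial state: register `0` holds the number of input integers, the next registers
hold these integers, and all the others hold `0`. -/
def start (x : List ℤ) : State := ⟨0, fun i => ((x.length : ℤ) :: x).getD i 0⟩

/-- The size of an input. -/
def inputSize (x : List ℤ) : ℕ := (x.map fun a => bits a + 1).sum

/-- Some program computes `out q` from `inp q` in polynomial time, for all `q : α`; the output
is read off the registers `0, 1, …`. -/
def PolyTime {α : Type} (inp out : α → List ℤ) : Prop :=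
  ∃ (P : List Instr) (p : Polynomial ℕ), ∀ q : α, ∃ (k : ℕ) (s : State),
    Exec P (start (inp q)) k s ∧ k ≤ p.eval (inputSize (inp q)) ∧
      ∀ (i : ℕ) (hi : i < (out q).length), s.reg i = (out q)[i]

end RAM

/-! ### Classes of switching constraints, smallness, weak compatibility -/

/-- A finitely parametrized class of feasible sets. -/
structure SwitchingClass where
  Input : Type
  enc : Input → List ℤ
  enc_injective : Function.Injective enc
  horizon : Input → ℝ
  feasible : ∀ I, Set (L2star (horizon I))

/-- The numbers of controls and of constraints are polynomial in the input size. -/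
def IsSmall (C : SwitchingClass) (d : C.Input → ℕ)
    (A : ∀ I, LinSystem (C.horizon I) (d I)) : Prop :=
  ∃ p : Polynomial ℕ, ∀ I, d I + 1 ≤ p.eval (RAM.inputSize (C.enc I)) ∧
    (A I).m ≤ p.eval (RAM.inputSize (C.enc I))

/-- An instance of the class together with a number `M ≥ 1` of grid cells. -/
structure GridQuery (C : SwitchingClass) where
  I : C.Input
  M : ℕ
  hM : 1 ≤ M

/-- A row of a constraint of the system, discretized with `N = ℓ M` grid cells: constraint `k`,
grid cell `i`. -/
structure RowQuery (C : SwitchingClass) (d : C.Input → ℕ)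
    (A : ∀ I, LinSystem (C.horizon I) (d I)) (ℓ : GridQuery C → ℕ) where
  g : GridQuery C
  k : Fin (A g.I).m
  i : Fin (ℓ g * g.M)

/-- A row together with a variable: the value of control `c` in grid cell `j`. -/
structure EntryQuery (C : SwitchingClass) (d : C.Input → ℕ)
    (A : ∀ I, LinSystem (C.horizon I) (d I)) (ℓ : GridQuery C → ℕ) where
  row : RowQuery C d A ℓ
  c : Fin (d row.g.I + 1)
  j : Fin (ℓ row.g * row.g.M)

/-- Numerator and denominator. -/
def ratCode (x : ℚ) : List ℤ := [x.num, x.den]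

/-- The extended formulations `X I`, described by the systems `A I`, are weakly compatible with
discretization. The refinement factor `ℓ` is computable in time polynomial in the input size of
the instance and the binary length of `M`; for each instance, its value is bounded by a
polynomial in the value of `M`. For `N = ℓ M`, conditions (c1) and (c2) hold, and each of the
polynomially (in `N`) many coefficients of the restricted operators is rational and computable
in time polynomial in the input size of the instance and the binary lengths of `N` and of the
indices of the coefficient. -/
def IsWeaklyCompatible (C : SwitchingClass) (d : C.Input → ℕ)
    (X : ∀ I, Set (Fin (d I + 1) → L2star (C.horizon I)))
    (A : ∀ I, LinSystem (C.horizon I) (d I)) : Prop :=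
  ∃ ℓ : GridQuery C → ℕ,
    RAM.PolyTime (fun g : GridQuery C => (g.M : ℤ) :: C.enc g.I) (fun g => [(ℓ g : ℤ)]) ∧
    (∀ I, ∃ q : Polynomial ℕ, ∀ (M : ℕ) (hM : 1 ≤ M), ℓ ⟨I, M, hM⟩ ≤ q.eval M) ∧
    (∀ g, 1 ≤ ℓ g) ∧
    -- (c1)
    (∀ g, projFirst (discretizeTuple (ℓ g * g.M) (X g.I)) =
      convexHull ℝ (discretize (ℓ g * g.M) (C.feasible g.I))) ∧
    -- (c2)
    (∀ g, ∀ k : Fin (A g.I).m, ∀ w : Fin (d g.I + 1) → L2star (C.horizon g.I),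
      (∀ c, w c ∈ stepSpace (C.horizon g.I) (ℓ g * g.M)) →
        ((A g.I).con k).op w ∈ stepSpace (C.horizon g.I) (ℓ g * g.M)) ∧
    -- (c3)
    ∃ (a : EntryQuery C d A ℓ → ℚ) (b : RowQuery C d A ℓ → ℚ),
      (∀ g k, HasCoefficients ((A g.I).con k).op (ℓ g * g.M)
        (fun i c j => (a ⟨⟨g, k, i⟩, c, j⟩ : ℝ)) (fun i => (b ⟨g, k, i⟩ : ℝ))) ∧
      RAM.PolyTime
        (fun e : EntryQuery C d A ℓ =>
          [((ℓ e.row.g * e.row.g.M : ℕ) : ℤ), (e.row.k : ℕ), (e.row.i : ℕ), (e.c : ℕ),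
            (e.j : ℕ)] ++ C.enc e.row.g.I)
        (fun e => ratCode (a e)) ∧
      RAM.PolyTime
        (fun r : RowQuery C d A ℓ =>
          [((ℓ r.g * r.g.M : ℕ) : ℤ), (r.k : ℕ), (r.i : ℕ)] ++ C.enc r.g.I)
        (fun r => ratCode (b r))

/-! ### Minimum dwell-time constraints -/

/-- `u` switches up at `τ ∈ (-∞,T)`: it is `0` a.e. just before and `1` a.e. just after `τ`. -/
def SwitchesUp {T : ℝ} (u : L2star T) (τ : ℝ) : Prop :=
  τ < T ∧ ∃ ε > 0, (∀ᵐ t ∂(halfLine T), t ∈ Ioo (τ - ε) τ → rep u t = 0) ∧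
    ∀ᵐ t ∂(halfLine T), t ∈ Ioo τ (τ + ε) → rep u t = 1

/-- `u` switches down at `τ ∈ (-∞,T)`. -/
def SwitchesDown {T : ℝ} (u : L2star T) (τ : ℝ) : Prop :=
  τ < T ∧ ∃ ε > 0, (∀ᵐ t ∂(halfLine T), t ∈ Ioo (τ - ε) τ → rep u t = 1) ∧
    ∀ᵐ t ∂(halfLine T), t ∈ Ioo τ (τ + ε) → rep u t = 0

/-- The feasible set `U(L,l)`. -/
def dwellSet (T L l : ℝ) : Set (L2star T) :=
  {u | u ∈ BVstar T {0, 1} ∧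
    (∀ τ, SwitchesUp u τ → ∀ s ∈ Ico τ (τ + L), ¬ SwitchesDown u s) ∧
    (∀ τ, SwitchesDown u τ → ∀ s ∈ Ico τ (τ + l), ¬ SwitchesUp u s)}

/-- The input of an instance: rational `T > 0` and `L, l ≥ 0` with `L + l > 0`. -/
structure DwellInput where
  T : ℚ
  L : ℚ
  l : ℚ
  T_pos : 0 < T
  L_nonneg : 0 ≤ L
  l_nonneg : 0 ≤ l
  add_pos : 0 < L + l

namespace DwellInput

/-- The input as a list of integers. -/
def enc (I : DwellInput) : List ℤ := ratCode I.T ++ ratCode I.L ++ ratCode I.l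

lemma enc_injective : Function.Injective enc := by
  rintro ⟨T, L, l, _, _, _, _⟩ ⟨T', L', l', _, _, _, _⟩ h
  simp only [enc, ratCode, List.cons_append, List.nil_append, List.cons.injEq, and_true,
    Nat.cast_inj] at h
  obtain ⟨h1, h2, h3, h4, h5, h6⟩ := h
  obtain rfl := Rat.ext h1 h2
  obtain rfl := Rat.ext h3 h4
  obtain rfl := Rat.ext h5 h6
  rfl

/-- `σ = ⌈2T/(L+l)⌉`. -/
def sigma (I : DwellInput) : ℤ := ⌈2 * I.T / (I.L + I.l)⌉

/-- The set `U(L,l)^ext` of pairs `(u, z) = (w 0, w 1)`. -/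
def ext (I : DwellInput) : Set (Fin (1 + 1) → L2star (I.T : ℝ)) :=
  {w | ValuesIn (w 0) (Icc 0 1) ∧ ValuesIn (w 1) (Icc 0 (I.sigma : ℝ)) ∧
    (∀ᵐ t ∂(volume.restrict (Ioo 0 (I.T : ℝ))),
      rep (w 1) t - rep (shift I.T I.L (Rat.cast_nonneg.2 I.L_nonneg) (w 1)) t ≤ rep (w 0) t) ∧
    (∀ᵐ t ∂(volume.restrict (Ioo 0 (I.T : ℝ))),
      rep (w 1) t - rep (shift I.T I.l (Rat.cast_nonneg.2 I.l_nonneg) (w 1)) t ≤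
        1 - rep (shift I.T I.l (Rat.cast_nonneg.2 I.l_nonneg) (w 0)) t) ∧
    DerivNonneg (w 1 - w 0) ∧ DerivNonneg (w 1)}

end DwellInput

/-- The class of minimum dwell-time constraints. -/
def dwellClass : SwitchingClass where
  Input := DwellInput
  enc := DwellInput.enc
  enc_injective := DwellInput.enc_injective
  horizon I := I.T
  feasible I := dwellSet I.T I.L I.l

end

/-! A feasible control has finitely many switches, so it is `Z - Y` with monotone integer-valued `Z`
and `Y` counting its upward and downward switches. In these terms the dwell-time constraints say `Y
t ≤ Z (t - L)` (each downward switch comes at least `L` after its upward switch) and `Z t ≤ 1 + Y (t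
- l)`. With `z = Z` and `Y = z - u` these are exactly the two shift inequalities of the extended
formulation, while `Dz ≥ Du` and `Dz ≥ 0` express monotonicity of `Y` and `Z`. Combining the two
inequalities gives `Z t ≤ 1 + Z (t - (L + l))`, whence `z ≤ σ`. So every feasible control lifts
(`exists_isSwitchingPair`, `DwellInput.exists_mem_ext`).

Conversely, let `(u, z)` solve the system and put `y = z - u`. The constraints needed for a
switching pair compare `z`, `y` and their shifts up to integer constants only, hence survive `x ↦ ⌊x
+ θ⌋` for every `θ` in `[0,1)`. Thus `⌊z + θ⌋ - ⌊y + θ⌋` is a feasible control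
(`DwellInput.exists_rounding`, `IsSwitchingPair.mem_dwellSet`). By Hermite's identity, averaging
over `θ = k/n` recovers `z` and `y` up to `1/n`, so `u` lies in the closed convex hull
(`mem_closure_convexHull_of_rounding`). For the reverse inclusion of the closure, the projection is
closed because `z` is bounded (`isClosed_image_zero`).

Counting and rounding both preserve piecewise constancy on any grid, and only finitely many feasible
controls live on a grid, so the discretized statement holds without closure. The grid is refined
only to make `L` and `l` whole numbers of cells: then the operators preserve the grid and have
explicit integer coefficients. All numbers to be computed are values of fixed arithmetic expressions
in the input, evaluated by straight-line programs.

The link between distributional derivatives and pointwise statements is mollification: testing with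
smoothed indicators of intervals yields differences of mollified values
(`integral_mul_deriv_plateau`), which converge almost everywhere. -/

/-! ### Straight-line arithmetic on random access machines -/

namespace RAM

/-- Arithmetic expressions; the variables are the registers of the machine. -/
inductive Arith where
  | const (c : ℤ)
  | var (i : ℕ)
  | add (e f : Arith)
  | sub (e f : Arith)
  | mul (e f : Arith)
  | div (e f : Arith)

namespace Arith

/-- The value of an expression for given contents of the registers. -/
def eval (r : ℕ → ℤ) : Arith → ℤ
  | const c => c
  | var i => r i
  | add e f => e.eval r + f.eval r
  | sub e f => e.eval r - f.eval r
  | mul e f => e.eval r * f.eval r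
  | div e f => e.eval r / f.eval r

/-- All variables are registers below `n`. -/
def VarsBelow (n : ℕ) : Arith → Prop
  | const _ => True
  | var i => i < n
  | add e f => e.VarsBelow n ∧ f.VarsBelow n
  | sub e f => e.VarsBelow n ∧ f.VarsBelow n
  | mul e f => e.VarsBelow n ∧ f.VarsBelow n
  | div e f => e.VarsBelow n ∧ f.VarsBelow n

/-- Code that evaluates an expression into register `d`, using the registers from `d` on. -/
def compile : Arith → ℕ → List Instr
  | const c, d => [.const d c]
  | var i, d => [.copy d i]
  | add e f, d => e.compile d ++ f.compile (d + 1) ++ [.add d d (d + 1)]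
  | sub e f, d => e.compile d ++ f.compile (d + 1) ++ [.sub d d (d + 1)]
  | mul e f, d => e.compile d ++ f.compile (d + 1) ++ [.mul d d (d + 1)]
  | div e f, d => e.compile d ++ f.compile (d + 1) ++ [.div d d (d + 1)]

/-- The cost of the compiled code. -/
def cost (r : ℕ → ℤ) : Arith → ℕ
  | const c => 1 + bits c
  | var i => 1 + bits (r i)
  | add e f => e.cost r + f.cost r + (1 + bits (e.eval r) + bits (f.eval r))
  | sub e f => e.cost r + f.cost r + (1 + bits (e.eval r) + bits (f.eval r))
  | mul e f => e.cost r + f.cost r + (1 + bits (e.eval r) + bits (f.eval r))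
  | div e f => e.cost r + f.cost r + (1 + bits (e.eval r) + bits (f.eval r))

/-- `1` if the two expressions have the same value, `0` otherwise. -/
def eqInd (e f : Arith) : Arith :=
  div (const 1) (add (mul (sub e f) (sub e f)) (const 1))

end Arith

/-- Integer division turns `1 / (x² + 1)` into a test for zero. Case distinctions thus become
arithmetic, and no program needs a jump. -/
lemma one_div_sq_add_one (x : ℤ) : 1 / (x * x + 1) = if x = 0 then 1 else 0 := by
  split_ifs with h
  · simp [h]
  · refine Int.ediv_eq_zero_of_lt (by norm_num) ?_
    have : 0 < x * x := mul_self_pos.2 h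
    linarith

@[simp] lemma Arith.eval_eqInd (r : ℕ → ℤ) (e f : Arith) :
    (e.eqInd f).eval r = if e.eval r = f.eval r then 1 else 0 := by
  simp only [Arith.eqInd, Arith.eval, one_div_sq_add_one, sub_eq_zero]

/-- Instructions that do not jump. -/
def Instr.IsStraight : Instr → Prop
  | .jump _ => False
  | .jumpPos _ _ => False
  | _ => True

lemma Instr.IsStraight.pc_next {i : Instr} (h : i.IsStraight) (s : State) :
    (i.next s).pc = s.pc + 1 := by
  cases i <;> first | rfl | exact h.elim

/-- The state after a straight-line code. -/
def run (s : State) (P : List Instr) : State := P.foldl Instr.next s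

/-- The cost of a straight-line code. -/
def runCost : State → List Instr → ℕ
  | _, [] => 0
  | s, i :: P => i.cost s + runCost (i.next s) P

lemma run_append (s : State) (P Q : List Instr) : run s (P ++ Q) = run (run s P) Q :=
  List.foldl_append

lemma runCost_append (s : State) (P Q : List Instr) :
    runCost s (P ++ Q) = runCost s P + runCost (run s P) Q := by
  induction P generalizing s with
  | nil => simp [runCost, run]
  | cons i P ih => simp [runCost, run, ih, add_assoc]

/-- Induction on the part `Q` of the program that is still to be run: without jumps, the program
counter advances by one and `Q` loses its head. -/
lemma exec_of_straight (P : List Instr) (hP : ∀ i ∈ P, i.IsStraight) (Q : List Instr) :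
    ∀ s : State, s.pc ≤ P.length → P.drop s.pc = Q → Exec P s (runCost s Q) (run s Q) := by
  induction Q with
  | nil =>
    intro s _ h
    exact Exec.halt s (List.getElem?_eq_none (List.drop_eq_nil_iff.1 h))
  | cons i Q ih =>
    intro s hs h
    have hlt : s.pc < P.length := by
      by_contra hge
      rw [List.drop_eq_nil_of_le (not_lt.1 hge)] at h
      exact List.cons_ne_nil _ _ h.symm
    rw [List.drop_eq_getElem_cons hlt, List.cons.injEq] at h
    have hi : P[s.pc]? = some i := by rw [List.getElem?_eq_getElem hlt, h.1]
    have hst : i.IsStraight := hP i (h.1 ▸ List.getElem_mem hlt)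
    have hpc := hst.pc_next s
    exact Exec.step s i _ _ hi (ih _ (by rw [hpc]; omega) (by rw [hpc]; exact h.2))

lemma Arith.isStraight_compile (e : Arith) : ∀ d, ∀ i ∈ e.compile d, i.IsStraight := by
  induction e <;> intro d i hi <;> simp only [Arith.compile, List.mem_append,
    List.mem_singleton] at hi
  case const => subst hi; trivial
  case var => subst hi; trivial
  all_goals
    rename_i ihe ihf
    rcases hi with (hi | hi) | hi
    · exact ihe _ _ hi
    · exact ihf _ _ hi
    · subst hi; trivial

lemma Arith.eval_congr {n : ℕ} {r r' : ℕ → ℤ} (h : ∀ i < n, r i = r' i) :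
    ∀ e : Arith, e.VarsBelow n → e.eval r = e.eval r' ∧ e.cost r = e.cost r' := by
  intro e
  induction e <;> intro he <;> simp only [Arith.VarsBelow] at he <;>
    simp only [Arith.eval, Arith.cost]
  case const => simp
  case var => simp [h _ he]
  all_goals
    rename_i ihe ihf
    simp [(ihe he.1).1, (ihe he.1).2, (ihf he.2).1, (ihf he.2).2]

/-- The registers from `d` on serve as a stack. Evaluating the second operand from `d + 1` on leaves
the first operand in `d` intact, and `n ≤ d` protects the variables. -/
lemma Arith.run_compile {n : ℕ} (e : Arith) (he : e.VarsBelow n) :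
    ∀ (d : ℕ) (s : State), n ≤ d →
      (run s (e.compile d)).reg d = e.eval s.reg ∧
      (∀ i < d, (run s (e.compile d)).reg i = s.reg i) ∧
      runCost s (e.compile d) = e.cost s.reg := by
  induction e with
  | const c =>
    intro d s _
    refine ⟨?_, fun i hi => ?_, ?_⟩
    · simp [Arith.compile, run, Instr.next, State.assign, Arith.eval]
    · simp [Arith.compile, run, Instr.next, State.assign, hi.ne]
    · simp [Arith.compile, runCost, Instr.cost, Arith.cost]
  | var c =>
    intro d s _
    refine ⟨?_, fun i hi => ?_, ?_⟩
    · simp [Arith.compile, run, Instr.next, State.assign, Arith.eval]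
    · simp [Arith.compile, run, Instr.next, State.assign, hi.ne]
    · simp [Arith.compile, runCost, Instr.cost, Arith.cost]
  | add e f ihe ihf | sub e f ihe ihf | mul e f ihe ihf | div e f ihe ihf =>
    intro d s hd
    obtain ⟨e1, e2, e3⟩ := ihe he.1 d s hd
    obtain ⟨f1, f2, f3⟩ := ihf he.2 (d + 1) (run s (e.compile d)) (by omega)
    have hc := Arith.eval_congr (r := (run s (e.compile d)).reg) (r' := s.reg)
      (fun i hi => e2 i (by omega)) f he.2
    rw [hc.1] at f1
    rw [hc.2] at f3
    have f0 := f2 d (by omega)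
    rw [e1] at f0
    refine ⟨?_, fun i hi => ?_, ?_⟩
    · simp only [Arith.compile, run_append, Arith.eval]
      simp [run, Instr.next, State.assign]
      rw [← run, ← run, f1, f0]
    · simp only [Arith.compile, run_append]
      simp [run, Instr.next, State.assign, hi.ne]
      rw [← run, ← run, f2 i (by omega), e2 i hi]
    · simp only [Arith.compile, runCost_append, run_append, Arith.cost, e3, f3]
      simp only [runCost, Instr.cost, f0, f1]
      omega

lemma bits_add_le (a b : ℤ) : bits (a + b) ≤ bits a + bits b + 1 := by
  unfold bits
  rw [Nat.size_le]
  have h1 := Nat.lt_size_self a.natAbs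
  have h2 := Nat.lt_size_self b.natAbs
  have h3 := Int.natAbs_add_le a b
  have h4 : 2 ^ a.natAbs.size ≤ 2 ^ (a.natAbs.size + b.natAbs.size) :=
    Nat.pow_le_pow_right (by norm_num) (by omega)
  have h5 : 2 ^ b.natAbs.size ≤ 2 ^ (a.natAbs.size + b.natAbs.size) :=
    Nat.pow_le_pow_right (by norm_num) (by omega)
  rw [pow_succ]
  omega

lemma bits_neg (a : ℤ) : bits (-a) = bits a := by simp [bits]

lemma bits_mul_le (a b : ℤ) : bits (a * b) ≤ bits a + bits b := by
  unfold bits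
  rw [Nat.size_le, Int.natAbs_mul, pow_add]
  exact Nat.mul_lt_mul_of_lt_of_lt (Nat.lt_size_self _) (Nat.lt_size_self _)

lemma bits_div_le (a b : ℤ) : bits (a / b) ≤ bits a :=
  Nat.size_le_size (Int.natAbs_ediv_le_natAbs a b)

lemma bits_getD_le (x : List ℤ) (i : ℕ) : bits (x.getD i 0) ≤ inputSize x := by
  induction x generalizing i with
  | nil => simp [bits]
  | cons a x ih =>
    have h : inputSize (a :: x) = bits a + 1 + inputSize x := by simp [inputSize]
    rw [h]
    cases i with
    | zero => simp; omega
    | succ i => simpa using (ih i).trans (by omega)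

lemma bits_start_le (x : List ℤ) (i : ℕ) :
    bits ((start x).reg i) ≤ inputSize x + bits x.length := by
  cases i with
  | zero => simp [start]
  | succ i => simpa [start] using (bits_getD_le x i).trans (by omega)

/-- Values and costs of an expression are bounded by polynomials in the size of the variables. -/
lemma Arith.exists_polynomial_bound (e : Arith) : ∃ p : Polynomial ℕ, ∀ (B : ℕ) (r : ℕ → ℤ),
    (∀ i, bits (r i) ≤ B) → bits (e.eval r) ≤ p.eval B ∧ e.cost r ≤ p.eval B := by
  induction e with
  | const c => exact ⟨Polynomial.C (1 + bits c), fun B r _ => by simp [Arith.eval, Arith.cost]⟩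
  | var i =>
    refine ⟨1 + Polynomial.X, fun B r h => ?_⟩
    have := h i
    simp only [Arith.eval, Arith.cost, Polynomial.eval_add, Polynomial.eval_one,
      Polynomial.eval_X]
    omega
  | add e f ihe ihf | sub e f ihe ihf | mul e f ihe ihf | div e f ihe ihf =>
    obtain ⟨p, hp⟩ := ihe
    obtain ⟨q, hq⟩ := ihf
    -- The subexpressions cost at most `p + q`, and the final instruction at most `1 + p + q`.
    refine ⟨2 * p + 2 * q + 1, fun B r h => ?_⟩
    obtain ⟨p1, p2⟩ := hp B r h
    obtain ⟨q1, q2⟩ := hq B r h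
    have ha := bits_add_le (e.eval r) (f.eval r)
    have hs := bits_add_le (e.eval r) (-f.eval r)
    rw [bits_neg, ← sub_eq_add_neg] at hs
    have hm := bits_mul_le (e.eval r) (f.eval r)
    have hd := bits_div_le (e.eval r) (f.eval r)
    simp only [Arith.eval, Arith.cost, Polynomial.eval_add, Polynomial.eval_mul,
      Polynomial.eval_one, Polynomial.eval_ofNat]
    omega

/-- The values of an arithmetic expression, followed by `1`, are computable in polynomial time. -/
lemma polyTime_arith {α : Type} {inp out : α → List ℤ} (n : ℕ) (e : Arith)
    (hn : ∀ q, (inp q).length = n) (he : e.VarsBelow (n + 1))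
    (hout : ∀ q, out q <+: [e.eval (start (inp q)).reg, 1]) : PolyTime inp out := by
  obtain ⟨p, hp⟩ := e.exists_polynomial_bound
  set d := n + 1 with hd
  set P := e.compile d ++ [Instr.copy 0 d, Instr.const 1 1] with hP
  have hst : ∀ i ∈ P, i.IsStraight := by
    intro i hi
    simp only [hP, List.mem_append, List.mem_cons, List.not_mem_nil, or_false] at hi
    rcases hi with hi | rfl | rfl
    · exact e.isStraight_compile d i hi
    · trivial
    · trivial
  -- Evaluation costs at most `p`, the copy `1 + p`, the constant `2`. The summand `bits n` accounts
  -- for register `0`, which holds the length of the input and is not counted in its size.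
  refine ⟨P, (2 * p + 3).comp (Polynomial.X + Polynomial.C (bits n)), fun q => ?_⟩
  have hex := exec_of_straight P hst P (start (inp q)) (Nat.zero_le _) (by simp [start])
  obtain ⟨r1, -, r3⟩ := e.run_compile he d (start (inp q)) le_rfl
  obtain ⟨b1, b2⟩ := hp (inputSize (inp q) + bits n) (start (inp q)).reg (fun i => by
    simpa [hn q] using bits_start_le (inp q) i)
  refine ⟨_, _, hex, ?_, ?_⟩
  · have h1 : bits 1 = 1 := by decide
    simp only [hP, runCost_append, r3, runCost, Instr.cost, r1, h1, Polynomial.eval_comp,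
      Polynomial.eval_add, Polynomial.eval_mul, Polynomial.eval_ofNat, Polynomial.eval_X,
      Polynomial.eval_C]
    omega
  · intro i hi
    have h2 : (out q)[i] = ([e.eval (start (inp q)).reg, 1] : List ℤ)[i]'(by
        exact lt_of_lt_of_le hi (hout q).length_le) := (hout q).getElem hi
    rw [h2]
    have h3 : i < 2 := by simpa using lt_of_lt_of_le hi (hout q).length_le
    simp only [hP, run_append]
    interval_cases i
    · simp [run, Instr.next, State.assign]
      rw [← run, r1]
    · simp [run, Instr.next, State.assign]

end RAM

/-! ### Elements of `L²_⋆(0,T)` -/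

section Basic

variable {T : ℝ}

lemma rep_eq_zero_of_neg (u : L2star T) : ∀ᵐ t ∂(halfLine T), t < 0 → rep u t = 0 := u.2

lemma L2star.ext_ae {u v : L2star T} (h : rep u =ᵐ[halfLine T] rep v) : u = v :=
  Subtype.ext (Lp.ext h)

lemma rep_add (u v : L2star T) : rep (u + v) =ᵐ[halfLine T] fun t => rep u t + rep v t :=
  Lp.coeFn_add (u : Lp ℝ 2 (halfLine T)) v

lemma rep_sub (u v : L2star T) : rep (u - v) =ᵐ[halfLine T] fun t => rep u t - rep v t :=
  Lp.coeFn_sub (u : Lp ℝ 2 (halfLine T)) v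

lemma rep_smul (c : ℝ) (u : L2star T) : rep (c • u) =ᵐ[halfLine T] fun t => c * rep u t :=
  Lp.coeFn_smul c (u : Lp ℝ 2 (halfLine T))

lemma rep_shift {r : ℝ} (hr : 0 ≤ r) (u : L2star T) :
    rep (shift T r hr u) =ᵐ[halfLine T] fun t => rep u (t - r) :=
  (memLp_shift hr u).coeFn_toLp

lemma rep_stepFun (N : ℕ) (v : Fin N → ℝ) : rep (stepFun T N v) =ᵐ[halfLine T] stepRep T N v :=
  (memLp_stepRep T N v).coeFn_toLp

/-- Constraints a.e. in `(0,T)` can be checked a.e. in `(-∞,T)`. -/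
lemma ae_Ioo_iff {p : ℝ → Prop} :
    (∀ᵐ t ∂(volume.restrict (Ioo 0 T)), p t) ↔ ∀ᵐ t ∂(halfLine T), 0 < t → p t := by
  rw [ae_restrict_iff' measurableSet_Ioo, ae_restrict_iff' measurableSet_Iio]
  refine Filter.eventually_congr (Filter.Eventually.of_forall fun t => ?_)
  simp only [mem_Ioo, mem_Iio]
  tauto

lemma ae_ne_zero : ∀ᵐ t ∂(halfLine T), t ≠ 0 :=
  ae_restrict_of_ae (Measure.ae_ne volume 0)

lemma valuesIn_iff {u : L2star T} {S : Set ℝ} :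
    ValuesIn u S ↔ ∀ᵐ t ∂(halfLine T), 0 < t → rep u t ∈ S := ae_Ioo_iff

/-- To the left of `0` the function vanishes, so the constraint holds there automatically. -/
lemma valuesIn_iff_of_zero_mem {u : L2star T} {S : Set ℝ} (h0 : (0 : ℝ) ∈ S) :
    ValuesIn u S ↔ ∀ᵐ t ∂(halfLine T), rep u t ∈ S := by
  rw [valuesIn_iff]
  constructor
  · intro h
    filter_upwards [h, rep_eq_zero_of_neg u, ae_ne_zero (T := T)] with t h1 h2 h3
    rcases lt_or_gt_of_ne h3 with h | h
    · rwa [h2 h]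
    · exact h1 h
  · intro h
    filter_upwards [h] with t ht _ using ht

lemma memLp_of_bounded {f : ℝ → ℝ} {C : ℝ} (hf : AEStronglyMeasurable f (halfLine T))
    (h0 : ∀ᵐ t ∂(halfLine T), t < 0 → f t = 0) (hC : ∀ᵐ t ∂(halfLine T), |f t| ≤ C) :
    MemLp f 2 (halfLine T) := by
  have hg : MemLp ((Icc 0 T).indicator fun _ => C) 2 (halfLine T) := by
    refine memLp_indicator_const 2 measurableSet_Icc C (Or.inr ?_)
    refine ne_top_of_le_ne_top ?_ (Measure.restrict_apply_le _ _)
    simp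
  refine hg.mono hf ?_
  filter_upwards [h0, hC, ae_restrict_mem (measurableSet_Iio (a := T))] with t h1 h2 h3
  by_cases h : t < 0
  · simp [h1 h]
  · rw [indicator_of_mem (show t ∈ Icc 0 T from ⟨not_lt.1 h, le_of_lt h3⟩)]
    exact h2.trans (le_abs_self C)

/-- Bounded measurable functions that vanish in `(-∞,0)` are in `L²_⋆(0,T)`. -/
lemma exists_rep_eq {f : ℝ → ℝ} {C : ℝ} (hf : AEStronglyMeasurable f (halfLine T))
    (h0 : ∀ᵐ t ∂(halfLine T), t < 0 → f t = 0) (hC : ∀ᵐ t ∂(halfLine T), |f t| ≤ C) :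
    ∃ u : L2star T, rep u =ᵐ[halfLine T] f := by
  refine ⟨⟨(memLp_of_bounded hf h0 hC).toLp f, ?_⟩, (memLp_of_bounded hf h0 hC).coeFn_toLp⟩
  filter_upwards [(memLp_of_bounded hf h0 hC).coeFn_toLp, h0] with t h1 h2 h
  rw [h1, h2 h]

/-- The function that is constant `1` in `(0,T)`. -/
noncomputable def unitFun (T : ℝ) : L2star T := stepFun T 1 fun _ => 1

end Basic

/-! ### Piecewise constant functions -/

section Step

variable {T : ℝ} {N : ℕ}

lemma gridCell_disjoint (hT : 0 < T) {i j : Fin N} {t : ℝ} (hi : t ∈ gridCell T N i)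
    (hj : t ∈ gridCell T N j) : i = j := by
  have hN : (0 : ℝ) < N := Nat.cast_pos.2 (Fin.pos i)
  have hd : 0 < T / N := by positivity
  have h1 := lt_of_mul_lt_mul_right (hi.1.trans hj.2) hd.le
  have h2 := lt_of_mul_lt_mul_right (hj.1.trans hi.2) hd.le
  have h3 : (i : ℕ) < j + 1 := by exact_mod_cast h1
  have h4 : (j : ℕ) < i + 1 := by exact_mod_cast h2
  exact Fin.ext (by omega)

lemma gridCell_subset (hT : 0 < T) (i : Fin N) : gridCell T N i ⊆ Ioo 0 T := by
  have hN : (0 : ℝ) < N := Nat.cast_pos.2 (Fin.pos i)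
  have hd : 0 < T / N := by positivity
  intro t ht
  refine ⟨lt_of_le_of_lt (by positivity) ht.1, lt_of_lt_of_le ht.2 ?_⟩
  have : ((i : ℝ) + 1) ≤ N := by exact_mod_cast i.2
  calc ((i : ℝ) + 1) * (T / N) ≤ N * (T / N) := by gcongr
    _ = T := by field_simp

lemma stepRep_of_mem (hT : 0 < T) (v : Fin N → ℝ) {i : Fin N} {t : ℝ}
    (ht : t ∈ gridCell T N i) : stepRep T N v t = v i := by
  unfold stepRep
  rw [Finset.sum_eq_single i, indicator_of_mem ht]
  · intro j _ hj
    exact indicator_of_notMem (fun h => hj (gridCell_disjoint hT h ht)) _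
  · simp

/-- Almost every point of `(0,T)` lies in a grid cell. -/
lemma ae_exists_gridCell (hT : 0 < T) (hN : 0 < N) :
    ∀ᵐ t ∂(halfLine T), 0 < t → ∃ i : Fin N, t ∈ gridCell T N i := by
  have hc : (range fun k : ℕ => (k : ℝ) * (T / N)).Countable := countable_range _
  have hN' : (0 : ℝ) < N := Nat.cast_pos.2 hN
  have hd : 0 < T / N := by positivity
  filter_upwards [ae_restrict_mem (measurableSet_Iio (a := T)),
    ae_restrict_of_ae (s := Iio T) (hc.ae_notMem volume)] with t h1 h2 h
  have hpos : 0 ≤ t / (T / N) := by positivity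
  have hle : (⌊t / (T / N)⌋₊ : ℝ) ≤ t / (T / N) := Nat.floor_le hpos
  have hlt : t / (T / N) < ⌊t / (T / N)⌋₊ + 1 := Nat.lt_floor_add_one _
  have hk : ⌊t / (T / N)⌋₊ < N := by
    rw [Nat.floor_lt hpos, div_lt_iff₀ hd]
    calc t < T := h1
      _ = N * (T / N) := by field_simp
  refine ⟨⟨_, hk⟩, lt_of_le_of_ne ?_ fun he => h2 ⟨_, he⟩, ?_⟩
  · rwa [le_div_iff₀ hd] at hle
  · rwa [div_lt_iff₀ hd] at hlt

/-- Two elements of `L²_⋆(0,T)` that agree a.e. in the grid cells are equal. -/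
lemma L2star.ext_gridCell (hT : 0 < T) (hN : 0 < N) {u v : L2star T}
    (h : ∀ᵐ t ∂(halfLine T), ∀ i : Fin N, t ∈ gridCell T N i → rep u t = rep v t) : u = v := by
  refine L2star.ext_ae ?_
  filter_upwards [h, ae_exists_gridCell hT hN, rep_eq_zero_of_neg u, rep_eq_zero_of_neg v,
    ae_ne_zero (T := T)] with t h1 h2 h3 h4 h5
  rcases lt_or_gt_of_ne h5 with h | h
  · rw [h3 h, h4 h]
  · obtain ⟨i, hi⟩ := h2 h
    exact h1 i hi

lemma rep_stepFun_gridCell (hT : 0 < T) (v : Fin N → ℝ) :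
    ∀ᵐ t ∂(halfLine T), ∀ i, t ∈ gridCell T N i → rep (stepFun T N v) t = v i := by
  filter_upwards [rep_stepFun N v] with t h i hi
  rw [h, stepRep_of_mem hT v hi]

lemma mem_stepSpace_of_ae (hT : 0 < T) (hN : 0 < N) {u : L2star T} (v : Fin N → ℝ)
    (h : ∀ᵐ t ∂(halfLine T), ∀ i, t ∈ gridCell T N i → rep u t = v i) : u ∈ stepSpace T N := by
  refine ⟨v, L2star.ext_gridCell hT hN ?_⟩
  filter_upwards [h, rep_stepFun_gridCell hT v] with t h1 h2 i hi
  rw [h1 i hi, h2 i hi]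

lemma rep_unitFun (hT : 0 < T) : ∀ᵐ t ∂(halfLine T), 0 < t → rep (unitFun T) t = 1 := by
  filter_upwards [ae_exists_gridCell (N := 1) hT one_pos,
    rep_stepFun_gridCell (N := 1) hT fun _ => 1] with t h1 h2 h
  obtain ⟨i, hi⟩ := h1 h
  exact h2 i hi

/-- The shift by `p` grid cells. -/
lemma rep_shift_stepFun (hT : 0 < T) {r : ℝ} (hr : 0 ≤ r) (p : ℕ) (hp : r = p * (T / N))
    (v : Fin N → ℝ) : ∀ᵐ t ∂(halfLine T), ∀ i : Fin N, t ∈ gridCell T N i →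
      rep (shift T r hr (stepFun T N v)) t =
        ∑ j : Fin N, (if (i : ℕ) = j + p then 1 else 0) * v j := by
  filter_upwards [rep_shift hr (stepFun T N v), ae_shift hr (rep_stepFun N v)] with t h1 h2 i hi
  have hN : (0 : ℝ) < N := Nat.cast_pos.2 (Fin.pos i)
  have hd : 0 < T / N := by positivity
  rw [h1, h2]
  by_cases hip : p ≤ i
  · have hcell : t - r ∈ gridCell T N ⟨i - p, by omega⟩ := by
      obtain ⟨a, b⟩ := hi
      have e : (((i : ℕ) - p : ℕ) : ℝ) = i - p := by rw [Nat.cast_sub hip]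
      constructor
      · simp only [e, hp]; linarith
      · simp only [e, hp]; linarith
    rw [stepRep_of_mem hT v hcell, Finset.sum_eq_single ⟨i - p, by omega⟩]
    · simp [Nat.sub_add_cancel hip]
    · intro j _ hj
      rw [if_neg, zero_mul]
      intro h
      exact hj (Fin.ext (by simp only; omega))
    · simp
  -- The first `p` cells are shifted in from the negative axis, where the function is `0`;
  -- correspondingly no `j` contributes to the sum.
  · have hneg : t - r < 0 := by
      have h3 : ((i : ℝ) + 1) ≤ p := by exact_mod_cast not_le.1 hip
      have := hi.2
      have : ((i : ℝ) + 1) * (T / N) ≤ p * (T / N) := by gcongr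
      linarith
    rw [stepRep_neg T N v _ hneg, Finset.sum_eq_zero]
    intro j _
    rw [if_neg (by omega), zero_mul]

lemma stepFun_add (v w : Fin N → ℝ) : stepFun T N (v + w) = stepFun T N v + stepFun T N w := by
  refine L2star.ext_ae ?_
  filter_upwards [rep_stepFun N v, rep_stepFun N w, rep_stepFun (T := T) N (v + w),
    rep_add (stepFun T N v) (stepFun T N w)] with t h1 h2 h3 h4
  rw [h3, h4, h1, h2, stepRep, stepRep, stepRep, ← Finset.sum_add_distrib]
  refine Finset.sum_congr rfl fun i _ => ?_
  by_cases h : t ∈ gridCell T N i <;> simp [h]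

lemma stepFun_smul (c : ℝ) (v : Fin N → ℝ) : stepFun T N (c • v) = c • stepFun T N v := by
  refine L2star.ext_ae ?_
  filter_upwards [rep_stepFun N v, rep_stepFun (T := T) N (c • v),
    rep_smul c (stepFun T N v)] with t h1 h3 h4
  rw [h3, h4, h1, stepRep, stepRep, Finset.mul_sum]
  refine Finset.sum_congr rfl fun i _ => ?_
  by_cases h : t ∈ gridCell T N i <;> simp [h]

lemma convex_stepSpace (T : ℝ) (N : ℕ) : Convex ℝ (stepSpace T N) := by
  rintro _ ⟨v, rfl⟩ _ ⟨w, rfl⟩ a b _ _ _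
  exact ⟨a • v + b • w, by rw [stepFun_add, stepFun_smul, stepFun_smul]⟩

end Step

/-! ### The linear system -/

/-- The coefficients of an affine combination of `u`, `z`, `V_L z`, `V_l u`, `V_l z` and `1`. -/
structure ShiftCoeffs where
  u : ℤ
  z : ℤ
  zL : ℤ
  ul : ℤ
  zl : ℤ
  one : ℤ

namespace ShiftCoeffs

variable {T L l : ℝ}

/-- The affine operator with given coefficients. -/
noncomputable def op (T : ℝ) (hL : 0 ≤ L) (hl : 0 ≤ l) (K : ShiftCoeffs) :
    (Fin (1 + 1) → L2star T) →ᴬ[ℝ] L2star T :=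
  (((K.u : ℝ) • ContinuousLinearMap.proj (R := ℝ) (φ := fun _ : Fin (1 + 1) => L2star T) 0 +
    (K.z : ℝ) • ContinuousLinearMap.proj (R := ℝ) (φ := fun _ : Fin (1 + 1) => L2star T) 1 +
    (K.zL : ℝ) • (shift T L hL).comp
      (ContinuousLinearMap.proj (R := ℝ) (φ := fun _ : Fin (1 + 1) => L2star T) 1) +
    (K.ul : ℝ) • (shift T l hl).comp
      (ContinuousLinearMap.proj (R := ℝ) (φ := fun _ : Fin (1 + 1) => L2star T) 0) +
    (K.zl : ℝ) • (shift T l hl).comp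
      (ContinuousLinearMap.proj (R := ℝ) (φ := fun _ : Fin (1 + 1) => L2star T) 1) :
    (Fin (1 + 1) → L2star T) →L[ℝ] L2star T)).toContinuousAffineMap +
  ContinuousAffineMap.const ℝ _ ((K.one : ℝ) • unitFun T)

lemma op_apply (hL : 0 ≤ L) (hl : 0 ≤ l) (K : ShiftCoeffs) (w : Fin (1 + 1) → L2star T) :
    K.op T hL hl w = (K.u : ℝ) • w 0 + (K.z : ℝ) • w 1 + (K.zL : ℝ) • shift T L hL (w 1) +
      (K.ul : ℝ) • shift T l hl (w 0) + (K.zl : ℝ) • shift T l hl (w 1) +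
      (K.one : ℝ) • unitFun T := by
  simp [op]

lemma rep_op (hT : 0 < T) (hL : 0 ≤ L) (hl : 0 ≤ l) (K : ShiftCoeffs)
    (w : Fin (1 + 1) → L2star T) : ∀ᵐ t ∂(halfLine T), 0 < t →
      rep (K.op T hL hl w) t = K.u * rep (w 0) t + K.z * rep (w 1) t +
        K.zL * rep (shift T L hL (w 1)) t + K.ul * rep (shift T l hl (w 0)) t +
        K.zl * rep (shift T l hl (w 1)) t + K.one := by
  rw [op_apply]
  filter_upwards [rep_smul K.u (w 0), rep_smul K.z (w 1), rep_smul K.zL (shift T L hL (w 1)),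
    rep_smul K.ul (shift T l hl (w 0)), rep_smul K.zl (shift T l hl (w 1)),
    rep_smul K.one (unitFun T), rep_unitFun hT,
    rep_add ((K.u : ℝ) • w 0) ((K.z : ℝ) • w 1),
    rep_add ((K.u : ℝ) • w 0 + (K.z : ℝ) • w 1) ((K.zL : ℝ) • shift T L hL (w 1)),
    rep_add ((K.u : ℝ) • w 0 + (K.z : ℝ) • w 1 + (K.zL : ℝ) • shift T L hL (w 1))
      ((K.ul : ℝ) • shift T l hl (w 0)),
    rep_add ((K.u : ℝ) • w 0 + (K.z : ℝ) • w 1 + (K.zL : ℝ) • shift T L hL (w 1) +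
      (K.ul : ℝ) • shift T l hl (w 0)) ((K.zl : ℝ) • shift T l hl (w 1)),
    rep_add ((K.u : ℝ) • w 0 + (K.z : ℝ) • w 1 + (K.zL : ℝ) • shift T L hL (w 1) +
      (K.ul : ℝ) • shift T l hl (w 0) + (K.zl : ℝ) • shift T l hl (w 1))
      ((K.one : ℝ) • unitFun T)] with t h1 h2 h3 h4 h5 h6 h7 a1 a2 a3 a4 a5 h
  rw [a5, a4, a3, a2, a1, h1, h2, h3, h4, h5, h6, h7 h, mul_one]

/-- The coefficient of the discretized operator in row `i` at the variable `(c, j)`, if the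
shifts are by `p` and by `q` grid cells. -/
def coeff (K : ShiftCoeffs) (p q : ℕ) (i c j : ℕ) : ℤ :=
  if c = 0 then K.u * (if i = j then 1 else 0) + K.ul * (if i = j + q then 1 else 0)
  else K.z * (if i = j then 1 else 0) + K.zL * (if i = j + p then 1 else 0) +
    K.zl * (if i = j + q then 1 else 0)

/-- As `L` and `l` are `p` and `q` cells, each shift maps cells to cells, so the matrix has entries
only on the diagonal and on the `p`-th and `q`-th subdiagonals. -/
lemma hasCoefficients (hT : 0 < T) (hL : 0 ≤ L) (hl : 0 ≤ l) (K : ShiftCoeffs) {N : ℕ}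
    (hN : 0 < N) {p q : ℕ} (hp : L = p * (T / N)) (hq : l = q * (T / N)) :
    HasCoefficients (K.op T hL hl) N (fun i c j => ((K.coeff p q i c j : ℤ) : ℝ))
      fun _ => (K.one : ℝ) := by
  intro v
  refine L2star.ext_gridCell hT hN ?_
  filter_upwards [rep_op hT hL hl K fun c => stepFun T N (v c),
    rep_stepFun_gridCell hT (v 0), rep_stepFun_gridCell hT (v 1),
    rep_shift_stepFun hT hL p hp (v 1), rep_shift_stepFun hT hl q hq (v 0),
    rep_shift_stepFun hT hl q hq (v 1), rep_stepFun_gridCell hT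
      (fun i => (∑ c : Fin (1 + 1), ∑ j : Fin N, ((K.coeff p q i c j : ℤ) : ℝ) * v c j) + K.one)]
    with t h h1 h2 h3 h4 h5 h6 i hi
  rw [h (gridCell_subset hT i hi).1, h1 i hi, h2 i hi, h3 i hi, h4 i hi, h5 i hi, h6 i hi]
  have hself : ∀ x : Fin N → ℝ, x i = ∑ j : Fin N, (if (i : ℕ) = j then 1 else 0) * x j := by
    intro x
    rw [Finset.sum_eq_single i]
    · simp
    · intro j _ hj
      rw [if_neg fun h => hj (Fin.ext h.symm), zero_mul]
    · simp
  rw [hself (v 0), hself (v 1)]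
  rw [Fin.sum_univ_two]
  have e0 : ∀ j : Fin N, ((K.coeff p q i ((0 : Fin (1 + 1)) : ℕ) j : ℤ) : ℝ) * v 0 j =
      K.u * ((if (i : ℕ) = j then 1 else 0) * v 0 j) +
      K.ul * ((if (i : ℕ) = j + q then 1 else 0) * v 0 j) := by
    intro j
    simp only [coeff]
    simp only [Fin.val_zero, if_true]
    push_cast
    ring
  have e1 : ∀ j : Fin N, ((K.coeff p q i ((1 : Fin (1 + 1)) : ℕ) j : ℤ) : ℝ) * v 1 j =
      K.z * ((if (i : ℕ) = j then 1 else 0) * v 1 j) +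
      K.zL * ((if (i : ℕ) = j + p then 1 else 0) * v 1 j) +
      K.zl * ((if (i : ℕ) = j + q then 1 else 0) * v 1 j) := by
    intro j
    simp only [coeff]
    simp only [Fin.val_one, one_ne_zero, if_false]
    push_cast
    ring
  simp only [e0, e1, Finset.sum_add_distrib, ← Finset.mul_sum]
  ring

end ShiftCoeffs

/-! ### Mollification -/

section Mollify

open Filter Topology

/-- Bump functions at `0` that shrink as `n` grows. -/
noncomputable def mollBump (n : ℕ) : ContDiffBump (0 : ℝ) where
  -- The ratio of the two radii stays bounded, as almost everywhere convergence of the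
  -- mollifications requires.
  rIn := 1 / (2 * ((n : ℝ) + 1))
  rOut := 1 / ((n : ℝ) + 1)
  rIn_pos := by positivity
  rIn_lt_rOut := by
    apply one_div_lt_one_div_of_lt (by positivity)
    have : (0 : ℝ) ≤ n := Nat.cast_nonneg n
    linarith

/-- A mollifier, supported in `[-1/(n+1), 1/(n+1)]`. -/
noncomputable def mollKernel (n : ℕ) : ℝ → ℝ := (mollBump n).normed volume

/-- A smooth approximation of the Heaviside function. -/
noncomputable def smoothStep (n : ℕ) (x : ℝ) : ℝ := ∫ t in (-1 : ℝ)..x, mollKernel n t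

lemma continuous_mollKernel (n : ℕ) : Continuous (mollKernel n) :=
  (mollBump n).continuous_normed

lemma support_mollKernel (n : ℕ) :
    Function.support (mollKernel n) = Ioo (-(1 / ((n : ℝ) + 1))) (1 / ((n : ℝ) + 1)) := by
  rw [mollKernel, ContDiffBump.support_normed_eq, Real.ball_eq_Ioo, zero_sub, zero_add]
  rfl

lemma mollRadius_le_one (n : ℕ) : 1 / ((n : ℝ) + 1) ≤ 1 := by
  rw [div_le_one (by positivity)]
  have : (0 : ℝ) ≤ n := Nat.cast_nonneg n
  linarith

lemma hasDerivAt_smoothStep (n : ℕ) (x : ℝ) : HasDerivAt (smoothStep n) (mollKernel n x) x :=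
  ((continuous_mollKernel n).integral_hasStrictDerivAt (-1) x).hasDerivAt

lemma deriv_smoothStep (n : ℕ) : deriv (smoothStep n) = mollKernel n :=
  funext fun x => (hasDerivAt_smoothStep n x).deriv

lemma differentiable_smoothStep (n : ℕ) : Differentiable ℝ (smoothStep n) :=
  fun x => (hasDerivAt_smoothStep n x).differentiableAt

lemma contDiff_smoothStep (n : ℕ) : ContDiff ℝ ∞ (smoothStep n) := by
  rw [contDiff_infty_iff_deriv, deriv_smoothStep]
  exact ⟨differentiable_smoothStep n, (mollBump n).contDiff_normed⟩

lemma monotone_smoothStep (n : ℕ) : Monotone (smoothStep n) := by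
  refine monotone_of_deriv_nonneg (differentiable_smoothStep n) fun x => ?_
  rw [deriv_smoothStep]
  exact (mollBump n).nonneg_normed x

lemma smoothStep_eq_zero {n : ℕ} {x : ℝ} (hx : x ≤ -(1 / ((n : ℝ) + 1))) :
    smoothStep n x = 0 := by
  have h0 : EqOn (mollKernel n) (fun _ => 0) (uIcc (-1) x) := by
    intro t ht
    by_contra h
    have h1 : t ∈ Function.support (mollKernel n) := h
    rw [support_mollKernel] at h1
    have h2 : t ≤ max (-1) x := ht.2
    have h3 : max (-1) x ≤ -(1 / ((n : ℝ) + 1)) :=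
      max_le (by have := mollRadius_le_one n; linarith) hx
    exact absurd h1.1 (not_lt.2 (h2.trans h3))
  rw [smoothStep, intervalIntegral.integral_congr h0, intervalIntegral.integral_zero]

lemma smoothStep_eq_one {n : ℕ} {x : ℝ} (hx : 1 / ((n : ℝ) + 1) ≤ x) : smoothStep n x = 1 := by
  rw [smoothStep, intervalIntegral.integral_eq_integral_of_support_subset,
    mollKernel, ContDiffBump.integral_normed]
  rw [support_mollKernel]
  intro t ht
  have := mollRadius_le_one n
  exact ⟨by linarith [ht.1], by linarith [ht.2]⟩

lemma smoothStep_nonneg (n : ℕ) (x : ℝ) : 0 ≤ smoothStep n x := by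
  rw [← smoothStep_eq_zero (n := n) (min_le_right x _)]
  exact monotone_smoothStep n (min_le_left _ _)

lemma smoothStep_le_one (n : ℕ) (x : ℝ) : smoothStep n x ≤ 1 := by
  rw [← smoothStep_eq_one (n := n) (le_max_right x _)]
  exact monotone_smoothStep n (le_max_left _ _)

/-- A smooth approximation of the indicator function of `(a,b)`. -/
noncomputable def plateau (n : ℕ) (a b x : ℝ) : ℝ := smoothStep n (x - a) - smoothStep n (x - b)

lemma plateau_nonneg (n : ℕ) {a b : ℝ} (hab : a ≤ b) (x : ℝ) : 0 ≤ plateau n a b x :=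
  sub_nonneg.2 (monotone_smoothStep n (by linarith))

lemma deriv_plateau (n : ℕ) (a b : ℝ) :
    deriv (plateau n a b) = fun x => mollKernel n (x - a) - mollKernel n (x - b) := by
  funext x
  exact (((hasDerivAt_smoothStep n (x - a)).comp_sub_const x a).sub
    ((hasDerivAt_smoothStep n (x - b)).comp_sub_const x b)).deriv

lemma isTestFun_plateau {T : ℝ} {n : ℕ} {a b : ℝ} (hab : a ≤ b)
    (hb : b + 1 / ((n : ℝ) + 1) < T) : IsTestFun T (plateau n a b) := by
  have hs : tsupport (plateau n a b) ⊆
      Icc (a - 1 / ((n : ℝ) + 1)) (b + 1 / ((n : ℝ) + 1)) := by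
    refine closure_minimal (fun x hx => ?_) isClosed_Icc
    by_contra h
    apply hx
    rw [mem_Icc, not_and_or, not_le, not_le] at h
    rcases h with h | h
    · rw [plateau, smoothStep_eq_zero (by linarith), smoothStep_eq_zero (by linarith), sub_zero]
    · rw [plateau, smoothStep_eq_one (by linarith), smoothStep_eq_one (by linarith), sub_self]
  refine ⟨?_, isCompact_Icc.of_isClosed_subset (isClosed_tsupport _) hs,
    hs.trans fun x hx => lt_of_le_of_lt hx.2 hb⟩
  exact ((contDiff_smoothStep n).comp (contDiff_id.sub contDiff_const)).sub
    ((contDiff_smoothStep n).comp (contDiff_id.sub contDiff_const))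

variable {T : ℝ}

/-- The mollified function. -/
noncomputable def mollify (u : L2star T) (n : ℕ) (x : ℝ) : ℝ :=
  ∫ y in Iio T, rep u y * mollKernel n (y - x)

lemma memLp_rep (u : L2star T) : MemLp (rep u) 2 (halfLine T) := 
  Lp.memLp (u : Lp ℝ 2 (halfLine T))

lemma IsTestFun.continuous_deriv {φ : ℝ → ℝ} (h : IsTestFun T φ) : Continuous (deriv φ) :=
  h.smooth.continuous_deriv (by simp)

lemma IsTestFun.memLp_deriv {φ : ℝ → ℝ} (h : IsTestFun T φ) : MemLp (deriv φ) 2 (halfLine T) :=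
  (h.continuous_deriv.memLp_of_hasCompactSupport h.compact.deriv).restrict _

lemma IsTestFun.integrable_mul_deriv {φ : ℝ → ℝ} (h : IsTestFun T φ) (u : L2star T) :
    Integrable (fun t => rep u t * deriv φ t) (halfLine T) :=
  (memLp_rep u).integrable_mul h.memLp_deriv

lemma integrable_mul_mollKernel (u : L2star T) (n : ℕ) (x : ℝ) :
    Integrable (fun y => rep u y * mollKernel n (y - x)) (halfLine T) := by
  refine (memLp_rep u).integrable_mul (q := 2) (MemLp.restrict _ ?_)
  refine Continuous.memLp_of_hasCompactSupport
    ((continuous_mollKernel n).comp (continuous_id.sub continuous_const)) ?_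
  exact (mollBump n).hasCompactSupport_normed.comp_homeomorph (Homeomorph.subRight x)

/-- This turns distributional information into pointwise information: as `n → ∞`, the right-hand
side tends to `u(a) - u(b)` for almost all `a` and `b`. -/
lemma integral_mul_deriv_plateau (u : L2star T) (n : ℕ) (a b : ℝ) :
    ∫ y in Iio T, rep u y * deriv (plateau n a b) y = mollify u n a - mollify u n b := by
  rw [mollify, mollify, ← integral_sub (integrable_mul_mollKernel u n a)
    (integrable_mul_mollKernel u n b), deriv_plateau]
  exact integral_congr_ae (Eventually.of_forall fun y => mul_sub _ _ _)

/-- Lebesgue differentiation, applied to the extension of `u` by zero beyond `T`; the kernel is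
even, so the mollification is a convolution. -/
lemma ae_tendsto_mollify (u : L2star T) : ∀ᵐ x ∂(halfLine T),
    Tendsto (fun n => mollify u n x) atTop (𝓝 (rep u x)) := by
  have hg : LocallyIntegrable ((Iio T).indicator (rep u)) volume :=
    ((memLp_indicator_iff_restrict measurableSet_Iio).2 (memLp_rep u)).locallyIntegrable
      (by norm_num)
  have h1 : Tendsto (fun n => (mollBump n).rOut) atTop (𝓝 0) :=
    tendsto_one_div_add_atTop_nhds_zero_nat
  have h2 : ∀ᶠ n in atTop, (mollBump n).rOut ≤ 2 * (mollBump n).rIn := by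
    refine Eventually.of_forall fun n => le_of_eq ?_
    simp only [mollBump]
    field_simp
  have h := ContDiffBump.ae_convolution_tendsto_right_of_locallyIntegrable (μ := volume) h1 h2 hg
  filter_upwards [ae_restrict_of_ae (s := Iio T) h,
    ae_restrict_mem (measurableSet_Iio (a := T))] with x hx hxT
  rw [indicator_of_mem hxT] at hx
  refine hx.congr fun n => ?_
  rw [convolution_eq_swap, mollify, ← integral_indicator measurableSet_Iio]
  refine integral_congr_ae (Eventually.of_forall fun y => ?_)
  have hk : (mollBump n).normed volume (x - y) = mollKernel n (y - x) := by
    rw [mollKernel, ← ContDiffBump.normed_neg, neg_sub]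
  simp only [ContinuousLinearMap.lsmul_apply, hk, smul_eq_mul]
  by_cases hy : y ∈ Iio T
  · rw [indicator_of_mem hy, indicator_of_mem hy, mul_comm]
  · rw [indicator_of_notMem hy, indicator_of_notMem hy, mul_zero]

lemma eventually_add_mollRadius_lt {b : ℝ} (hb : b < T) :
    ∀ᶠ n : ℕ in atTop, b + 1 / ((n : ℝ) + 1) < T := by
  have h := (tendsto_one_div_add_atTop_nhds_zero_nat (𝕜 := ℝ)).const_add b
  rw [add_zero] at h
  exact h.eventually (gt_mem_nhds hb)

/-- A function with nonnegative distributional derivative is a.e. monotone. -/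
lemma DerivNonneg.rep_le {u : L2star T} (hu : DerivNonneg u) {a b : ℝ} (hab : a ≤ b) (hb : b < T)
    (ha' : Tendsto (fun n => mollify u n a) atTop (𝓝 (rep u a)))
    (hb' : Tendsto (fun n => mollify u n b) atTop (𝓝 (rep u b))) : rep u a ≤ rep u b := by
  refine le_of_tendsto_of_tendsto ha' hb' ?_
  filter_upwards [eventually_add_mollRadius_lt hb] with n hn
  have h := hu _ (isTestFun_plateau hab hn) (plateau_nonneg n hab)
  rw [distribDeriv, integral_mul_deriv_plateau] at h
  linarith

/-- A bounded function with nonnegative distributional derivative has a monotone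
representative. -/
lemma DerivNonneg.exists_monotone {u : L2star T} (hu : DerivNonneg u) {C : ℝ}
    (hC : ∀ᵐ t ∂(halfLine T), |rep u t| ≤ C) :
    ∃ f : ℝ → ℝ, Monotone f ∧ rep u =ᵐ[halfLine T] f := by
  -- On this conull set the chosen representative itself is monotone and bounded, so it extends to a
  -- monotone function on the line.
  set D : Set ℝ := {x | x < T ∧ |rep u x| ≤ C ∧
    Tendsto (fun n => mollify u n x) atTop (𝓝 (rep u x))} with hD
  have hm : MonotoneOn (rep u) D := fun a ha b hb hab => hu.rep_le hab hb.1 ha.2.2 hb.2.2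
  obtain ⟨f, hf, he⟩ := hm.exists_monotone_extension
    ⟨-C, by rintro _ ⟨x, hx, rfl⟩; exact (abs_le.1 hx.2.1).1⟩
    ⟨C, by rintro _ ⟨x, hx, rfl⟩; exact (abs_le.1 hx.2.1).2⟩
  refine ⟨f, hf, ?_⟩
  filter_upwards [hC, ae_tendsto_mollify u, ae_restrict_mem (measurableSet_Iio (a := T))]
    with x h1 h2 h3
  exact he ⟨h3, h1, h2⟩

end Mollify

/-! ### Monotone integer-valued functions -/

section IntStep

variable {T : ℝ}

lemma IsTestFun.apply_right {φ : ℝ → ℝ} (h : IsTestFun T φ) : φ T = 0 :=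
  image_eq_zero_of_notMem_tsupport fun hT => lt_irrefl T (h.supp hT)

/-- Up to its endpoint, a nonempty upper set bounded below is a ray `(τ, ∞)`, where the fundamental
theorem of calculus applies. -/
lemma exists_integral_indicator_deriv {S : Set ℝ} (hS : IsUpperSet S) (h0 : S ⊆ Ici 0) :
    ∃ τ, ∀ φ, IsTestFun T φ →
      ∫ t in Iio T, S.indicator (fun _ => (1 : ℝ)) t * deriv φ t = -φ τ := by
  rcases S.eq_empty_or_nonempty with rfl | hne
  -- Every test function vanishes at `T`, so `T` stands for a jump that never occurs.
  · exact ⟨T, fun φ hφ => by simp [hφ.apply_right]⟩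
  · refine ⟨sInf S, fun φ hφ => ?_⟩
    have hb : BddBelow S := ⟨0, h0⟩
    rw [setIntegral_eq_integral_of_forall_compl_eq_zero,
      ← HasCompactSupport.integral_Ioi_deriv_eq (hφ.smooth.of_le (by simp)) hφ.compact,
      ← integral_indicator measurableSet_Ioi]
    · refine integral_congr_ae ?_
      filter_upwards [Measure.ae_ne volume (sInf S)] with t ht
      rcases lt_or_gt_of_ne ht with h | h
      · rw [indicator_of_notMem (fun hm => absurd (csInf_le hb hm) (not_le.2 h)),
          indicator_of_notMem (show t ∉ Ioi (sInf S) from not_lt.2 h.le), zero_mul]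
      · obtain ⟨s, hs, hst⟩ := exists_lt_of_csInf_lt hne h
        rw [indicator_of_mem (hS hst.le hs), indicator_of_mem (show t ∈ Ioi (sInf S) from h),
          one_mul]
    · intro t ht
      have : deriv φ t = 0 := by
        by_contra h
        exact ht (hφ.supp (support_deriv_subset h))
      rw [this, mul_zero]

lemma Monotone.int_nonneg {f : ℝ → ℤ} (hf : Monotone f) (h0 : ∀ t < 0, f t = 0) (t : ℝ) :
    0 ≤ f t := by
  rw [← h0 (min t (-1)) (lt_of_le_of_lt (min_le_right _ _) (by norm_num))]
  exact hf (min_le_left _ _)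

/-- The distributional derivative of a monotone integer-valued function is a finite sum of
Dirac measures. -/
lemma exists_integral_int_mul_deriv {f : ℝ → ℤ} (hf : Monotone f) (h0 : ∀ t < 0, f t = 0)
    {C : ℕ} (hC : ∀ t < T, f t ≤ C) :
    ∃ τ : ℕ → ℝ, ∀ φ, IsTestFun T φ →
      ∫ t in Iio T, (f t : ℝ) * deriv φ t = -∑ m ∈ Finset.range C, φ (τ m) := by
  -- Layer-cake decomposition: `f` is the sum of the indicators of `{f ≥ m + 1}` for `m < C`, each
  -- an upper set by monotonicity.
  set S : ℕ → Set ℝ := fun m => {t | (m : ℤ) + 1 ≤ f t} with hS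
  have hup : ∀ m, IsUpperSet (S m) := fun m s t hst hs => le_trans hs (hf hst)
  have hsub : ∀ m, S m ⊆ Ici 0 := by
    intro m t ht
    by_contra h
    have h1 := h0 t (not_le.1 h)
    have h2 : (m : ℤ) + 1 ≤ f t := ht
    omega
  choose τ hτ using fun m => exists_integral_indicator_deriv (T := T) (hup m) (hsub m)
  refine ⟨τ, fun φ hφ => ?_⟩
  have hsum : ∀ t ∈ Iio T, (f t : ℝ) * deriv φ t =
      ∑ m ∈ Finset.range C, (S m).indicator (fun _ => (1 : ℝ)) t * deriv φ t := by
    intro t ht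
    rw [← Finset.sum_mul]
    congr 1
    obtain ⟨k, hk⟩ := Int.eq_ofNat_of_zero_le (hf.int_nonneg h0 t)
    have hkC : k ≤ C := by have := hC t ht; omega
    have hi : ∀ m, (S m).indicator (fun _ => (1 : ℝ)) t = if m < k then 1 else 0 := by
      intro m
      by_cases h : m < k
      · rw [if_pos h, indicator_of_mem]
        change (m : ℤ) + 1 ≤ f t
        omega
      · rw [if_neg h, indicator_of_notMem]
        change ¬ (m : ℤ) + 1 ≤ f t
        omega
    simp only [hi, hk]
    rw [Finset.sum_ite, Finset.sum_const_zero, add_zero, Finset.sum_const]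
    have : (Finset.range C).filter (· < k) = Finset.range k := by
      ext m; simp; omega
    simp [this]
  rw [setIntegral_congr_fun measurableSet_Iio hsum, integral_finsetSum,
    Finset.sum_congr rfl fun m _ => hτ m φ hφ, Finset.sum_neg_distrib]
  intro m _
  have hφ_int : Integrable (deriv φ) (halfLine T) :=
    (hφ.continuous_deriv.integrable_of_hasCompactSupport hφ.compact.deriv).restrict
  simp only [← smul_eq_mul]
  refine Integrable.bdd_mul (c := 1) hφ_int ?_ ?_
  · exact (stronglyMeasurable_const.indicator (hup m).ordConnected.measurableSet).aestronglyMeasurable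
  · refine Filter.Eventually.of_forall fun t => ?_
    by_cases h : t ∈ S m <;> simp [h]

lemma distribDeriv_congr {u : L2star T} {f : ℝ → ℝ} (hu : rep u =ᵐ[halfLine T] f) (φ : ℝ → ℝ) :
    ∫ t in Iio T, rep u t * deriv φ t = ∫ t in Iio T, f t * deriv φ t :=
  integral_congr_ae (by filter_upwards [hu] with t ht; rw [ht])

lemma derivNonneg_of_int_monotone {u : L2star T} {f : ℝ → ℤ} (hf : Monotone f)
    (h0 : ∀ t < 0, f t = 0) {C : ℕ} (hC : ∀ t < T, f t ≤ C)
    (hu : rep u =ᵐ[halfLine T] fun t => (f t : ℝ)) : DerivNonneg u := by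
  obtain ⟨τ, hτ⟩ := exists_integral_int_mul_deriv hf h0 hC
  intro φ hφ hpos
  rw [distribDeriv, distribDeriv_congr hu, hτ φ hφ, neg_neg]
  exact Finset.sum_nonneg fun m _ => hpos _

lemma integrable_int_mul_deriv {f : ℝ → ℤ} (hf : Monotone f) (h0 : ∀ t < 0, f t = 0)
    {C : ℕ} (hC : ∀ t < T, f t ≤ C) {φ : ℝ → ℝ} (hφ : IsTestFun T φ) :
    Integrable (fun t => (f t : ℝ) * deriv φ t) (halfLine T) := by
  have hφ_int : Integrable (deriv φ) (halfLine T) :=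
    (hφ.continuous_deriv.integrable_of_hasCompactSupport hφ.compact.deriv).restrict
  have hmono : Monotone fun t => (f t : ℝ) := fun s t h => Int.cast_le.2 (hf h)
  refine Integrable.bdd_mul (c := C) hφ_int hmono.measurable.aestronglyMeasurable ?_
  filter_upwards [ae_restrict_mem (measurableSet_Iio (a := T))] with t ht
  rw [Real.norm_eq_abs, abs_of_nonneg (Int.cast_nonneg (hf.int_nonneg h0 t))]
  exact_mod_cast hC t ht

/-- The difference of two bounded monotone integer-valued functions has bounded variation. -/
lemma variation_lt_top_of_int_monotone {u : L2star T} {f g : ℝ → ℤ} (hf : Monotone f)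
    (hg : Monotone g) (hf0 : ∀ t < 0, f t = 0) (hg0 : ∀ t < 0, g t = 0) {C : ℕ}
    (hfC : ∀ t < T, f t ≤ C) (hgC : ∀ t < T, g t ≤ C)
    (hu : rep u =ᵐ[halfLine T] fun t => (f t : ℝ) - g t) : variation u < ⊤ := by
  obtain ⟨τ, hτ⟩ := exists_integral_int_mul_deriv hf hf0 hfC
  obtain ⟨ρ, hρ⟩ := exists_integral_int_mul_deriv hg hg0 hgC
  refine lt_of_le_of_lt ?_ (ENNReal.ofReal_lt_top (r := 2 * C))
  refine iSup_le fun φ => iSup_le fun hφ => iSup_le fun hb => ENNReal.ofReal_le_ofReal ?_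
  rw [distribDeriv_congr hu]
  simp only [sub_mul]
  rw [integral_sub (integrable_int_mul_deriv hf hf0 hfC hφ)
    (integrable_int_mul_deriv hg hg0 hgC hφ), hτ φ hφ, hρ φ hφ]
  have hle : ∀ σ : ℕ → ℝ, |∑ m ∈ Finset.range C, φ (σ m)| ≤ C := by
    intro σ
    refine (Finset.abs_sum_le_sum_abs _ _).trans ?_
    refine (Finset.sum_le_sum fun m _ => hb (σ m)).trans ?_
    simp
  have h1 := abs_le.1 (hle τ)
  have h2 := abs_le.1 (hle ρ)
  linarith [h1.1, h2.2]

end IntStep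

/-! ### Counting switches -/

section Switching

open Filter Topology

variable {T L l : ℝ}

/-- The function `u` is, a.e., the difference of the monotone integer-valued functions `Z` and
`Y`, which count the upward and the downward switches and obey the dwell-time constraints. -/
structure IsSwitchingPair (L l : ℝ) (u : L2star T) (Z Y : ℝ → ℤ) (C : ℕ) : Prop where
  monoZ : Monotone Z
  monoY : Monotone Y
  zeroZ : ∀ t < 0, Z t = 0
  zeroY : ∀ t < 0, Y t = 0
  leZ : ∀ t < T, Z t ≤ C
  leY : ∀ t < T, Y t ≤ C
  rep_eq : rep u =ᵐ[halfLine T] fun t => (Z t : ℝ) - Y t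
  values : ∀ᵐ t ∂(halfLine T), Z t = Y t ∨ Z t = Y t + 1
  up : ∀ᵐ t ∂(halfLine T), Y t ≤ Z (t - L)
  down : ∀ᵐ t ∂(halfLine T), Z t ≤ 1 + Y (t - l)

lemma exists_mem_Ioo_of_ae {p : ℝ → Prop} (h : ∀ᵐ t ∂(halfLine T), p t) {a b : ℝ} (hab : a < b)
    (ha : a < T) : ∃ t, a < t ∧ t < b ∧ t < T ∧ p t := by
  by_contra hno
  push Not at hno
  have hsub : Ioo a (min b T) ⊆ {t | t ∈ Iio T → p t}ᶜ := by
    intro t ht hp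
    have h1 := lt_of_lt_of_le ht.2 (min_le_left _ _)
    have h2 := lt_of_lt_of_le ht.2 (min_le_right _ _)
    exact hno t ht.1 h1 h2 (hp h2)
  have hnull := measure_mono_null hsub ((ae_restrict_iff' measurableSet_Iio).1 h)
  rw [Real.volume_Ioo, ENNReal.ofReal_eq_zero] at hnull
  have := lt_min hab ha
  linarith

/-- If an upward switch were followed too soon by a downward one, there would be `a < b < c` with `c
- L ≤ a` and values `0, 1, 0`. Then `Y c = Z c ≥ Z b = Y b + 1 ≥ Y a + 1 = Z a + 1`, contradicting
`Y c ≤ Z (c - L) ≤ Z a`. The other case is symmetric, with `Z c ≤ 1 + Y (c - l)`. -/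
lemma IsSwitchingPair.mem_dwellSet {u : L2star T} {Z Y : ℝ → ℤ} {C : ℕ}
    (h : IsSwitchingPair L l u Z Y C) : u ∈ dwellSet T L l := by
  refine ⟨⟨variation_lt_top_of_int_monotone h.monoZ h.monoY h.zeroZ h.zeroY h.leZ h.leY
    h.rep_eq, ?_⟩, ?_, ?_⟩
  · rw [valuesIn_iff]
    filter_upwards [h.rep_eq, h.values] with t h1 h2 _
    rw [h1]
    rcases h2 with h2 | h2 <;> simp [h2]
  · rintro τ ⟨hτ, ε, hε, u1, -⟩ s ⟨hs1, hs2⟩ ⟨hs, δ, hδ, d1, d2⟩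
    have hall := (h.rep_eq.and h.up).and (u1.and (d1.and d2))
    -- Choosing `a > s - L` leaves room for a point `c` with `s < c < a + L`.
    obtain ⟨a, a1, a2, aT, ⟨ae, -⟩, au, -, -⟩ := exists_mem_Ioo_of_ae hall
      (show max (τ - ε) (s - L) < τ from max_lt (by linarith) (by linarith))
      (max_lt (by linarith) (by linarith))
    rw [max_lt_iff] at a1
    obtain ⟨b, b1, b2, bT, ⟨be, -⟩, -, bd, -⟩ := exists_mem_Ioo_of_ae hall
      (show max (s - δ) a < s from max_lt (by linarith) (by linarith))
      (max_lt (by linarith) (by linarith))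
    rw [max_lt_iff] at b1
    obtain ⟨c, c1, c2, cT, ⟨ce, cu⟩, -, -, cd⟩ := exists_mem_Ioo_of_ae hall
      (show s < min (s + δ) (a + L) from lt_min (by linarith) (by linarith)) hs
    rw [lt_min_iff] at c2
    rw [au ⟨a1.1, a2⟩] at ae
    rw [bd ⟨b1.1, b2⟩] at be
    rw [cd ⟨c1, c2.1⟩] at ce
    have ae' : Z a = Y a := by
      have : (Z a : ℝ) = Y a := by linarith
      exact_mod_cast this
    have be' : Z b = Y b + 1 := by
      have : (Z b : ℝ) = Y b + 1 := by linarith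
      exact_mod_cast this
    have ce' : Z c = Y c := by
      have : (Z c : ℝ) = Y c := by linarith
      exact_mod_cast this
    have i1 := h.monoZ (show c - L ≤ a by linarith)
    have i2 := h.monoY b1.2.le
    have i3 := h.monoZ (show b ≤ c by linarith)
    omega
  · rintro τ ⟨hτ, ε, hε, u1, -⟩ s ⟨hs1, hs2⟩ ⟨hs, δ, hδ, d1, d2⟩
    have hall := (h.rep_eq.and h.down).and (u1.and (d1.and d2))
    obtain ⟨a, a1, a2, aT, ⟨ae, -⟩, au, -, -⟩ := exists_mem_Ioo_of_ae hall
      (show max (τ - ε) (s - l) < τ from max_lt (by linarith) (by linarith))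
      (max_lt (by linarith) (by linarith))
    rw [max_lt_iff] at a1
    obtain ⟨b, b1, b2, bT, ⟨be, -⟩, -, bd, -⟩ := exists_mem_Ioo_of_ae hall
      (show max (s - δ) a < s from max_lt (by linarith) (by linarith))
      (max_lt (by linarith) (by linarith))
    rw [max_lt_iff] at b1
    obtain ⟨c, c1, c2, cT, ⟨ce, cu⟩, -, -, cd⟩ := exists_mem_Ioo_of_ae hall
      (show s < min (s + δ) (a + l) from lt_min (by linarith) (by linarith)) hs
    rw [lt_min_iff] at c2
    rw [au ⟨a1.1, a2⟩] at ae
    rw [bd ⟨b1.1, b2⟩] at be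
    rw [cd ⟨c1, c2.1⟩] at ce
    have ae' : Z a = Y a + 1 := by
      have : (Z a : ℝ) = Y a + 1 := by linarith
      exact_mod_cast this
    have be' : Z b = Y b := by
      have : (Z b : ℝ) = Y b := by linarith
      exact_mod_cast this
    have ce' : Z c = Y c + 1 := by
      have : (Z c : ℝ) = Y c + 1 := by linarith
      exact_mod_cast this
    have i1 := h.monoY (show c - l ≤ a by linarith)
    have i2 := h.monoZ b1.2.le
    have i3 := h.monoY (show b ≤ c by linarith)
    omega

/-- There are `k` successive pairs of points of `G` up to time `t` at which `U` has the values
`0` and `1`. -/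
def UpChain (G : Set ℝ) (U : ℝ → ℝ) : ℕ → ℝ → Prop
  | 0, _ => True
  | k + 1, t => ∃ a b, a ∈ G ∧ b ∈ G ∧ UpChain G U k a ∧ a < b ∧ b ≤ t ∧ U a = 0 ∧ U b = 1

/-! ### Combinatorics of alternating values -/

section Chains

variable {G : Set ℝ} {U : ℝ → ℝ}

lemma UpChain.mono {k : ℕ} {s t : ℝ} (h : UpChain G U k s) (hst : s ≤ t) : UpChain G U k t := by
  cases k with
  | zero => trivial
  | succ k =>
    obtain ⟨a, b, ha, hb, hc, hab, hbt, h0, h1⟩ := h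
    exact ⟨a, b, ha, hb, hc, hab, hbt.trans hst, h0, h1⟩

lemma UpChain.of_succ {k : ℕ} {t : ℝ} (h : UpChain G U (k + 1) t) : UpChain G U k t := by
  obtain ⟨a, b, -, -, hc, hab, hbt, -⟩ := h
  exact hc.mono (hab.le.trans hbt)

lemma UpChain.of_le {k m : ℕ} {t : ℝ} (h : UpChain G U m t) (hk : k ≤ m) : UpChain G U k t := by
  induction hk with
  | refl => exact h
  | step _ ih => exact ih h.of_succ

lemma UpChain.mono_set {G' : Set ℝ} (hG : G ⊆ G') {k : ℕ} {t : ℝ} (h : UpChain G U k t) :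
    UpChain G' U k t := by
  induction k generalizing t with
  | zero => trivial
  | succ k ih =>
    obtain ⟨a, b, ha, hb, hc, h⟩ := h
    exact ⟨a, b, hG ha, hG hb, ih hc, h⟩

/-- Lengths of chains up to `t` are closed downward and bounded, so the maximal length characterizes
all of them. This maximum is the number of upward switches. -/
lemma exists_upCount {K : ℕ} (hK : ∀ k t, UpChain G U k t → k ≤ K) :
    ∃ Z : ℝ → ℕ, ∀ k t, UpChain G U k t ↔ k ≤ Z t := by
  classical
  refine ⟨fun t => Nat.findGreatest (fun k => UpChain G U k t) K, fun k t => ⟨fun h => ?_,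
    fun h => ?_⟩⟩
  · exact Nat.le_findGreatest (hK k t h) h
  · have h0 : UpChain G U (Nat.findGreatest (fun k => UpChain G U k t) K) t :=
      Nat.findGreatest_spec (P := fun k => UpChain G U k t) (Nat.zero_le K) trivial
    exact h0.of_le h

lemma monotone_upCount {Z : ℝ → ℕ} (hZ : ∀ k t, UpChain G U k t ↔ k ≤ Z t) : Monotone Z :=
  fun s t hst => (hZ _ t).1 (((hZ _ s).2 le_rfl).mono hst)

open Classical in
/-- The number of downward switches. -/
lemma exists_downCount (hU : ∀ t ∈ G, U t = 0 ∨ U t = 1) {K : ℕ}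
    (hK : ∀ k t, UpChain G U k t → k ≤ K) {Z : ℝ → ℕ}
    (hZ : ∀ k t, UpChain G U k t ↔ k ≤ Z t) :
    ∃ Y : ℝ → ℤ, Monotone Y ∧ ∀ t ∈ G, Y t = (Z t : ℤ) - if U t = 1 then 1 else 0 := by
  -- `Z - U` can decrease only when `U` rises from `0` to `1`; but then the two points extend the
  -- chain and `Z` rises as well.
  have hm : MonotoneOn (fun t => (Z t : ℤ) - if U t = 1 then 1 else 0) G := by
    intro s hs t ht hst
    have hZst := monotone_upCount hZ hst
    rcases hst.eq_or_lt with rfl | hlt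
    · rfl
    rcases hU s hs with h0 | h1
    · rcases hU t ht with h2 | h3
      · simp [h0, h2, hZst]
      · have : Z s + 1 ≤ Z t := (hZ _ t).1 ⟨s, t, hs, ht, (hZ _ s).2 le_rfl, hlt, le_rfl, h0, h3⟩
        simp only [h0, h3, zero_ne_one, if_false, if_true]
        omega
    · rcases hU t ht with h2 | h3
      · simp only [h1, h2, zero_ne_one, if_false, if_true]
        omega
      · simp [h1, h3, hZst]
  obtain ⟨Y, hY, he⟩ := hm.exists_monotone_extension (β := ℤ)
    ⟨-1, by
      rintro _ ⟨x, -, rfl⟩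
      dsimp only
      split_ifs <;> omega⟩
    ⟨K, by
      rintro _ ⟨x, -, rfl⟩
      have := hK _ x ((hZ _ x).2 le_rfl)
      dsimp only
      split_ifs <;> omega⟩
  exact ⟨Y, hY, fun t ht => (he ht).symm⟩

/-- Going back by at most `L` from a point where `U = 0` does not change the number of upward
switches. -/
lemma UpChain.back_of_zero (hU : ∀ t ∈ G, U t = 0 ∨ U t = 1)
    (hup : ∀ a ∈ G, ∀ b ∈ G, ∀ c ∈ G, a < b → b < c → U a = 0 → U b = 1 → U c = 0 → L < c - a)
    {p q : ℝ} (hp : p ∈ G) (hq : q ∈ G) (hpq : q ≤ p + L) (h0 : U q = 0) {k : ℕ}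
    (h : UpChain G U k q) : UpChain G U k p := by
  cases k with
  | zero => trivial
  | succ k =>
    obtain ⟨a, b, ha, hb, hc, hab, hbq, ha0, hb1⟩ := h
    have hbq' : b < q := lt_of_le_of_ne hbq (by rintro rfl; rw [h0] at hb1; exact zero_ne_one hb1)
    by_cases hbp : b ≤ p
    · exact ⟨a, b, ha, hb, hc, hab, hbp, ha0, hb1⟩
    rw [not_le] at hbp
    -- Here `b` lies between `p` and `q`. If `U p = 1`, then `p` replaces `b` in the chain. If `U p
    -- = 0`, or if `p ≤ a`, the values `0, 1, 0` occur within a time of at most `L`.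
    by_cases hap : a < p
    · rcases hU p hp with hp0 | hp1
      · have := hup p hp b hb q hq hbp hbq' hp0 hb1 h0
        linarith
      · exact ⟨a, p, ha, hp, hc, hap, le_rfl, ha0, hp1⟩
    · have := hup a ha b hb q hq hab hbq' ha0 hb1 h0
      linarith

/-- Going back by at most `l` to a point where `U = 1` does not change the number of upward
switches. -/
lemma UpChain.back_to_one
    (hdown : ∀ a ∈ G, ∀ b ∈ G, ∀ c ∈ G, a < b → b < c → U a = 1 → U b = 0 → U c = 1 → l < c - a)
    {p t : ℝ} (hp : p ∈ G) (hpt : t ≤ p + l) (h1 : U p = 1) {k : ℕ}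
    (h : UpChain G U k t) : UpChain G U k p := by
  cases k with
  | zero => trivial
  | succ k =>
    obtain ⟨a, b, ha, hb, hc, hab, hbt, ha0, hb1⟩ := h
    by_cases hbp : b ≤ p
    · exact ⟨a, b, ha, hb, hc, hab, hbp, ha0, hb1⟩
    rcases lt_trichotomy a p with hap | rfl | hap
    · exact ⟨a, p, ha, hp, hc, hap, le_rfl, ha0, h1⟩
    · rw [h1] at ha0
      exact absurd ha0 one_ne_zero
    · have := hdown p hp a ha b hb hap hab h1 ha0 hb1
      linarith

/-- Going back by at most `l` removes at most one upward switch. -/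
lemma UpChain.back_succ
    (hdown : ∀ a ∈ G, ∀ b ∈ G, ∀ c ∈ G, a < b → b < c → U a = 1 → U b = 0 → U c = 1 → l < c - a)
    {p t : ℝ} (hpt : t ≤ p + l) {k : ℕ}
    (h : UpChain G U (k + 1) t) : UpChain G U k p := by
  cases k with
  | zero => trivial
  | succ k =>
    -- If the last but one pair ended after `p`, then `b < c < d` would show the values `1, 0, 1`
    -- within less than `l`. So only the last pair can be lost.
    obtain ⟨c, d, hc, hd, ⟨a, b, ha, hb, hch, hab, hbc, ha0, hb1⟩, hcd, hdt, hc0, hd1⟩ := h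
    by_cases hbp : b ≤ p
    · exact ⟨a, b, ha, hb, hch, hab, hbp, ha0, hb1⟩
    have hbc' : b < c := lt_of_le_of_ne hbc (by rintro rfl; rw [hc0] at hb1; exact zero_ne_one hb1)
    have := hdown b hb c hc d hd hbc' hcd hb1 hc0 hd1
    linarith

end Chains

/-- Points at which a control with values in `{0,1}` is the limit of its mollifications. -/
def goodPoints (u : L2star T) : Set ℝ :=
  {x | x < T ∧ (rep u x = 0 ∨ rep u x = 1) ∧ (x < 0 → rep u x = 0) ∧
    Tendsto (fun n => mollify u n x) atTop (𝓝 (rep u x))}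

lemma ae_mem_goodPoints {u : L2star T} (hu : ValuesIn u {0, 1}) :
    ∀ᵐ t ∂(halfLine T), t ∈ goodPoints u := by
  rw [valuesIn_iff_of_zero_mem (by simp)] at hu
  filter_upwards [hu, rep_eq_zero_of_neg u, ae_tendsto_mollify u,
    ae_restrict_mem (measurableSet_Iio (a := T))] with t h1 h2 h3 h4
  exact ⟨h4, by simpa using h1, h2, h3⟩

lemma IsTestFun.add {φ ψ : ℝ → ℝ} (hφ : IsTestFun T φ) (hψ : IsTestFun T ψ) :
    IsTestFun T (φ + ψ) :=
  ⟨hφ.smooth.add hψ.smooth, hφ.compact.add hψ.compact,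
    (tsupport_add φ ψ).trans (union_subset hφ.supp hψ.supp)⟩

lemma IsTestFun.neg {φ : ℝ → ℝ} (hφ : IsTestFun T φ) : IsTestFun T (-φ) := by
  refine ⟨hφ.smooth.neg, hφ.compact.neg, ?_⟩
  have : tsupport (-φ) = tsupport φ := by simp [tsupport, Function.support_neg]
  rw [this]
  exact hφ.supp

lemma IsTestFun.differentiableAt {φ : ℝ → ℝ} (hφ : IsTestFun T φ) (x : ℝ) :
    DifferentiableAt ℝ φ x := (hφ.smooth.differentiable (by simp)) x

/-- Test functions that detect the upward switches of a chain. -/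
lemma UpChain.exists_testFun {u : L2star T} {k : ℕ} {t : ℝ}
    (h : UpChain (goodPoints u) (rep u) k t) :
    ∃ F : ℕ → ℝ → ℝ, (∀ᶠ n in atTop, IsTestFun T (F n)) ∧
      (∀ n x, 0 ≤ F n x ∧ F n x ≤ 1 - smoothStep n (x - t)) ∧
      Tendsto (fun n => ∫ y in Iio T, rep u y * deriv (F n) y) atTop (𝓝 (-k)) := by
  induction k generalizing t with
  | zero =>
    refine ⟨fun _ _ => 0, Eventually.of_forall fun n => ⟨contDiff_const,
      HasCompactSupport.zero, ?_⟩, fun n x => ⟨le_rfl, ?_⟩, ?_⟩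
    · have : tsupport (fun _ : ℝ => (0 : ℝ)) = ∅ := tsupport_eq_empty_iff.2 rfl
      simp [this]
    · linarith [smoothStep_le_one n (x - t)]
    · simp
  | succ k ih =>
    obtain ⟨a, b, ha, hb, hc, hab, hbt, ha0, hb1⟩ := h
    obtain ⟨F, hF, hFb, hFl⟩ := ih hc
    refine ⟨fun n => F n + plateau n a b, ?_, fun n x => ⟨?_, ?_⟩, ?_⟩
    · filter_upwards [hF, eventually_add_mollRadius_lt hb.1] with n h1 h2
      exact h1.add (isTestFun_plateau hab.le h2)
    · exact add_nonneg (hFb n x).1 (plateau_nonneg n hab.le x)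
    -- The bound telescopes: what `F n` leaves free beyond `a` is the smooth step at `a`, and the
    -- plateau uses it up only until `b ≤ t`. This keeps the sum below `1`, however many pairs there
    -- are.
    · have h1 := (hFb n x).2
      have h2 := monotone_smoothStep n (show x - t ≤ x - b by linarith)
      simp only [Pi.add_apply, plateau]
      linarith
    · have hlim := hFl.add (ha.2.2.2.sub hb.2.2.2)
      rw [ha0, hb1] at hlim
      have e : (-(k : ℝ) + (0 - 1)) = -((k + 1 : ℕ) : ℝ) := by push_cast; ring
      rw [e] at hlim
      refine hlim.congr' ?_
      filter_upwards [hF, eventually_add_mollRadius_lt hb.1] with n h1 h2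
      have h3 := isTestFun_plateau hab.le h2
      rw [← integral_mul_deriv_plateau, ← integral_add (h1.integrable_mul_deriv u)
        (h3.integrable_mul_deriv u)]
      refine integral_congr_ae (Eventually.of_forall fun y => ?_)
      dsimp only
      rw [deriv_add (h1.differentiableAt y) (h3.differentiableAt y), mul_add]

/-- Each pair of the chain contributes `-1` to the limit of the pairings, and the negated test
functions are admissible in the supremum defining the variation. -/
lemma UpChain.le_variation {u : L2star T} {k : ℕ} {t : ℝ} (hv : variation u < ⊤)
    (h : UpChain (goodPoints u) (rep u) k t) : (k : ℝ) ≤ (variation u).toReal := by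
  obtain ⟨F, hF, hFb, hFl⟩ := h.exists_testFun
  have hl := hFl.neg
  rw [neg_neg] at hl
  refine le_of_tendsto hl ?_
  filter_upwards [hF] with n hn
  have he : -∫ y in Iio T, rep u y * deriv (F n) y = ∫ y in Iio T, rep u y * deriv (-F n) y := by
    rw [← integral_neg]
    refine integral_congr_ae (Eventually.of_forall fun y => ?_)
    simp [deriv.neg']
  rw [he]
  refine (ENNReal.ofReal_le_iff_le_toReal hv.ne).1 ?_
  refine le_iSup_of_le (-F n) (le_iSup_of_le hn.neg (le_iSup_of_le (fun x => ?_) le_rfl))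
  have h1 := hFb n x
  have h2 := smoothStep_nonneg n (x - t)
  rw [Pi.neg_apply, abs_neg, abs_of_nonneg h1.1]
  linarith

lemma exists_upChain_bound {u : L2star T} (hv : variation u < ⊤) :
    ∃ K : ℕ, ∀ k t, UpChain (goodPoints u) (rep u) k t → k ≤ K := by
  obtain ⟨K, hK⟩ := exists_nat_ge (variation u).toReal
  exact ⟨K, fun k t h => by exact_mod_cast (h.le_variation hv).trans hK⟩

/-- A conull set on which a function is locally constant, and has one-sided limits at every
point of the line. -/
structure IsLocallyConstantOn (T : ℝ) (G : Set ℝ) (U : ℝ → ℝ) : Prop where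
  ae_mem : ∀ᵐ t ∂(halfLine T), t ∈ G
  left : ∀ τ, ∃ c, ∀ᶠ x in 𝓝[<] τ, x ∈ G → U x = c
  loc : ∀ t ∈ G, ∀ᶠ x in 𝓝 t, x ∈ G → U x = U t

-- On the good points `u` is a difference of monotone integer-valued functions. These have only
-- countably many discontinuities, which are removed; continuity into a discrete space is local
-- constancy, and left limits exist everywhere.
open Classical in
lemma exists_isLocallyConstantOn {u : L2star T} (hu : u ∈ BVstar T {0, 1}) :
    ∃ G ⊆ goodPoints u, IsLocallyConstantOn T G (rep u) := by
  obtain ⟨hv, hval⟩ := hu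
  obtain ⟨K, hK⟩ := exists_upChain_bound hv
  obtain ⟨Z', hZ'⟩ := exists_upCount hK
  obtain ⟨Y, hY, hYe⟩ := exists_downCount (fun t ht => ht.2.1) hK hZ'
  set Z : ℝ → ℤ := fun t => (Z' t : ℤ) with hZdef
  have hZ : Monotone Z := fun s t h => Int.ofNat_le.2 (monotone_upCount hZ' h)
  have heq : ∀ t ∈ goodPoints u, rep u t = (Z t : ℝ) - Y t := by
    intro t ht
    have h := hYe t ht
    rcases ht.2.1 with h0 | h1
    · rw [h0] at h ⊢
      simp only [zero_ne_one, if_false, sub_zero] at h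
      rw [h]; simp [hZdef]
    · rw [h1] at h ⊢
      simp only [if_true] at h
      rw [h]; simp [hZdef]
  refine ⟨goodPoints u \ ({x | ¬ContinuousAt Z x} ∪ {x | ¬ContinuousAt Y x}), sdiff_subset,
    ?_, ?_, ?_⟩
  · have hc := hZ.countable_not_continuousAt.union hY.countable_not_continuousAt
    filter_upwards [ae_mem_goodPoints hval, ae_restrict_of_ae (s := Iio T) (hc.ae_notMem volume)]
      with t h1 h2
    exact ⟨h1, h2⟩
  · intro τ
    have h1 := hZ.tendsto_nhdsLT τ
    have h2 := hY.tendsto_nhdsLT τ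
    rw [nhds_discrete, tendsto_pure] at h1 h2
    refine ⟨(sSup (Z '' Iio τ) : ℤ) - (sSup (Y '' Iio τ) : ℤ), ?_⟩
    filter_upwards [h1, h2] with x h3 h4 hx
    rw [heq x hx.1, h3, h4]
  · rintro t ⟨ht, hc⟩
    simp only [mem_union, mem_ofPred_eq, not_or, not_not] at hc
    have h1 := hc.1
    have h2 := hc.2
    rw [ContinuousAt, nhds_discrete ℤ, tendsto_pure] at h1 h2
    filter_upwards [h1, h2] with x h3 h4 hx
    rw [heq x hx.1, heq t ht, h3, h4]

/-- Between two points with different values there is a switching time. -/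
lemma IsLocallyConstantOn.exists_switch {G : Set ℝ} {U : ℝ → ℝ} (hG : IsLocallyConstantOn T G U)
    {c d : ℝ} (hcd : c ≠ d) (hU : ∀ t ∈ G, U t = c ∨ U t = d) {s t : ℝ} (hs : s ∈ G) (ht : t ∈ G)
    (hst : s < t) (htT : t < T) (hsc : U s = c) (htd : U t = d) :
    ∃ τ ∈ Ioo s t, ∃ ε > 0, (∀ x ∈ Ioo (τ - ε) τ, x ∈ G → U x = c) ∧
      ∀ x ∈ Ioo τ (τ + ε), x ∈ G → U x = d := by
  -- The switching time is the last time `τ` at which the value `c` is approached. Local constancy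
  -- at `s` and `t` puts it strictly between them.
  set A : Set ℝ := {x | x ∈ G ∧ x ∈ Icc s t ∧ U x = c} with hA
  have hsA : s ∈ A := ⟨hs, ⟨le_rfl, hst.le⟩, hsc⟩
  have hbdd : BddAbove A := ⟨t, fun x hx => hx.2.1.2⟩
  set τ := sSup A with hτ
  have hright : ∀ x ∈ G, τ < x → x ≤ t → U x = d := by
    intro x hx h1 h2
    refine (hU x hx).resolve_left fun h => ?_
    have hsx : s ≤ x := (le_csSup hbdd hsA).trans h1.le
    exact absurd (le_csSup hbdd (show x ∈ A from ⟨hx, ⟨hsx, h2⟩, h⟩)) (not_le.2 h1)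
  have hnear : ∀ a ∈ G, a < t → U a = c → ∃ x ∈ G, a < x ∧ x < t ∧ U x = c := by
    intro a ha hat hac
    obtain ⟨ε, hε, hball⟩ := Metric.eventually_nhds_iff.1 (hG.loc a ha)
    obtain ⟨x, h1, h2, -, h4⟩ := exists_mem_Ioo_of_ae hG.ae_mem
      (show a < min t (a + ε) from lt_min hat (by linarith)) (hat.trans htT)
    rw [lt_min_iff] at h2
    refine ⟨x, h4, h1, h2.1, ?_⟩
    rw [hball (by rw [Real.dist_eq, abs_lt]; constructor <;> linarith) h4, hac]
  have hsτ : s < τ := by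
    obtain ⟨x, hx, h1, h2, h3⟩ := hnear s hs hst hsc
    exact h1.trans_le (le_csSup hbdd ⟨hx, ⟨h1.le, h2.le⟩, h3⟩)
  have hτt : τ < t := by
    obtain ⟨ε, hε, hball⟩ := Metric.eventually_nhds_iff.1 (hG.loc t ht)
    refine lt_of_le_of_lt (csSup_le ⟨s, hsA⟩ fun x hx => ?_) (show t - ε < t by linarith)
    by_contra h
    rw [not_le] at h
    have h1 := hball (y := x) (by
      rw [Real.dist_eq, abs_lt]; constructor <;> linarith [hx.2.1.2]) hx.1
    rw [hx.2.2, htd] at h1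
    exact hcd h1
  obtain ⟨c', hc'⟩ := hG.left τ
  obtain ⟨m, hm, hsub⟩ := (mem_nhdsLT_iff_exists_Ioo_subset' hsτ).1 hc'
  -- Points of `A` accumulate at `τ` from the left: if `τ` itself were in `A`, local constancy would
  -- give points with value `c` to its right.
  have hc'c : c' = c := by
    obtain ⟨x, hx, hmx⟩ := exists_lt_of_lt_csSup ⟨s, hsA⟩ (show m < sSup A from hm)
    rcases (le_csSup hbdd hx).eq_or_lt with he | hlt
    · exfalso
      obtain ⟨y, hy, h1, h2, h3⟩ := hnear x hx.1 (by rw [he]; exact hτt) hx.2.2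
      have h4 := hright y hy (by rw [hτ, ← he]; exact h1) h2.le
      rw [h3] at h4
      exact hcd h4
    · exact (hsub ⟨hmx, hlt⟩ hx.1).symm.trans hx.2.2
  have hm' : m < τ := hm
  refine ⟨τ, ⟨hsτ, hτt⟩, min (τ - m) (t - τ), lt_min (by linarith) (by linarith), ?_, ?_⟩
  · intro x hx hxG
    have h1 := min_le_left (τ - m) (t - τ)
    rw [← hc'c]
    exact hsub ⟨by linarith [hx.1], hx.2⟩ hxG
  · intro x hx hxG
    have h1 := min_le_right (τ - m) (t - τ)
    exact hright x hxG hx.1 (by linarith [hx.2])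

/-! ### Switching counts of feasible controls -/

section Dwell

variable {u : L2star T} {G : Set ℝ}

lemma IsLocallyConstantOn.exists_switchesUp (hG : IsLocallyConstantOn T G (rep u))
    (hsub : G ⊆ goodPoints u) {s t : ℝ} (hs : s ∈ G) (ht : t ∈ G) (hst : s < t)
    (h0 : rep u s = 0) (h1 : rep u t = 1) : ∃ τ ∈ Ioo s t, SwitchesUp u τ := by
  obtain ⟨τ, hτ, ε, hε, ha, hb⟩ := hG.exists_switch zero_ne_one (fun x hx => (hsub hx).2.1) hs ht
    hst (hsub ht).1 h0 h1
  refine ⟨τ, hτ, hτ.2.trans (hsub ht).1, ε, hε, ?_, ?_⟩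
  · filter_upwards [hG.ae_mem] with x hx hx' using ha x hx' hx
  · filter_upwards [hG.ae_mem] with x hx hx' using hb x hx' hx

lemma IsLocallyConstantOn.exists_switchesDown (hG : IsLocallyConstantOn T G (rep u))
    (hsub : G ⊆ goodPoints u) {s t : ℝ} (hs : s ∈ G) (ht : t ∈ G) (hst : s < t)
    (h1 : rep u s = 1) (h0 : rep u t = 0) : ∃ τ ∈ Ioo s t, SwitchesDown u τ := by
  obtain ⟨τ, hτ, ε, hε, ha, hb⟩ := hG.exists_switch one_ne_zero
    (fun x hx => (hsub hx).2.1.symm) hs ht hst (hsub ht).1 h1 h0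
  refine ⟨τ, hτ, hτ.2.trans (hsub ht).1, ε, hε, ?_, ?_⟩
  · filter_upwards [hG.ae_mem] with x hx hx' using ha x hx' hx
  · filter_upwards [hG.ae_mem] with x hx hx' using hb x hx' hx

open Classical in
/-- Controls that obey the dwell-time constraints are differences of switching counts; if the
control is piecewise constant on a grid, then so are the counts. -/
lemma exists_isSwitchingPair (hT : 0 < T) (hL : 0 ≤ L) (hl : 0 ≤ l) (hu : u ∈ dwellSet T L l) :
    ∃ (Z Y : ℝ → ℤ) (C : ℕ), IsSwitchingPair L l u Z Y C ∧
      ∀ N, 0 < N → u ∈ stepSpace T N → ∃ v : Fin N → ℝ, ∀ᵐ t ∂(halfLine T),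
        ∀ i, t ∈ gridCell T N i → (Z t : ℝ) = v i := by
  obtain ⟨hBV, hdu, hdd⟩ := hu
  obtain ⟨G, hsub, hG⟩ := exists_isLocallyConstantOn hBV
  obtain ⟨K, hK'⟩ := exists_upChain_bound hBV.1
  have hK : ∀ k t, UpChain G (rep u) k t → k ≤ K := fun k t h => hK' k t (h.mono_set hsub)
  have hU : ∀ t ∈ G, rep u t = 0 ∨ rep u t = 1 := fun t ht => (hsub ht).2.1
  obtain ⟨Z, hZ⟩ := exists_upCount hK
  obtain ⟨Y, hY, hYe⟩ := exists_downCount hU hK hZ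
  have hY0 : ∀ t ∈ G, rep u t = 0 → Y t = Z t := by
    intro t ht h
    rw [hYe t ht, h]
    simp
  have hY1 : ∀ t ∈ G, rep u t = 1 → Y t = Z t - 1 := by
    intro t ht h
    rw [hYe t ht, h]
    simp
  have hup : ∀ a ∈ G, ∀ b ∈ G, ∀ c ∈ G, a < b → b < c → rep u a = 0 → rep u b = 1 →
      rep u c = 0 → L < c - a := by
    intro a ha b hb c hc hab hbc ha0 hb1 hc0
    obtain ⟨τ, hτ, hτu⟩ := hG.exists_switchesUp hsub ha hb hab ha0 hb1
    obtain ⟨s, hs, hsd⟩ := hG.exists_switchesDown hsub hb hc hbc hb1 hc0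
    by_contra h
    exact hdu τ hτu s ⟨(hτ.2.trans hs.1).le, by linarith [hτ.1, hs.2]⟩ hsd
  have hdown : ∀ a ∈ G, ∀ b ∈ G, ∀ c ∈ G, a < b → b < c → rep u a = 1 → rep u b = 0 →
      rep u c = 1 → l < c - a := by
    intro a ha b hb c hc hab hbc ha0 hb1 hc0
    obtain ⟨τ, hτ, hτu⟩ := hG.exists_switchesDown hsub ha hb hab ha0 hb1
    obtain ⟨s, hs, hsd⟩ := hG.exists_switchesUp hsub hb hc hbc hb1 hc0
    by_contra h
    exact hdd τ hτu s ⟨(hτ.2.trans hs.1).le, by linarith [hτ.1, hs.2]⟩ hsd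
  have hZneg : ∀ t < 0, Z t = 0 := by
    intro t ht
    by_contra h
    obtain ⟨a, b, -, hb, -, -, hbt, -, hb1⟩ := (hZ 1 t).2 (Nat.one_le_iff_ne_zero.2 h)
    rw [(hsub hb).2.2.1 (hbt.trans_lt ht)] at hb1
    exact zero_ne_one hb1
  have hYneg' : ∀ t ∈ G, t < 0 → Y t = 0 := by
    intro t ht h
    rw [hY0 t ht ((hsub ht).2.2.1 h), hZneg t h, Nat.cast_zero]
  have hshift : ∀ r : ℝ, 0 ≤ r → ∀ᵐ t ∂(halfLine T), t - r ∈ G := fun r hr =>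
    ae_shift hr hG.ae_mem
  refine ⟨fun t => Z t, Y, K, ⟨fun s t h => Int.ofNat_le.2 (monotone_upCount hZ h), hY,
    fun t ht => by simp [hZneg t ht], ?_, fun t _ => ?_, ?_, ?_, ?_, ?_, ?_⟩, ?_⟩
  -- Outside `G` the values of `Y` come from an arbitrary monotone extension; they are squeezed
  -- between values at points of `G`.
  · intro t ht
    obtain ⟨a, -, a2, -, a4⟩ := exists_mem_Ioo_of_ae hG.ae_mem
      (show t - 1 < t by linarith) (by linarith)
    obtain ⟨b, b1, b2, -, b4⟩ := exists_mem_Ioo_of_ae hG.ae_mem ht (by linarith)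
    have h1 := hY a2.le
    have h2 := hY b1.le
    rw [hYneg' a a4 (a2.trans ht)] at h1
    rw [hYneg' b b4 b2] at h2
    exact le_antisymm h2 h1
  · exact Int.ofNat_le.2 (hK _ t ((hZ _ t).2 le_rfl))
  · intro t ht
    obtain ⟨b, b1, b2, -, b4⟩ := exists_mem_Ioo_of_ae hG.ae_mem ht ht
    refine (hY b1.le).trans ?_
    have h1 := hK _ b ((hZ _ b).2 le_rfl)
    have h2 := hYe b b4
    split_ifs at h2 <;> omega
  · filter_upwards [hG.ae_mem] with t ht
    rcases hU t ht with h | h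
    · rw [h, hY0 t ht h]; simp
    · rw [h, hY1 t ht h]; simp
  · filter_upwards [hG.ae_mem] with t ht
    rcases hU t ht with h | h
    · exact Or.inl (hY0 t ht h).symm
    · exact Or.inr (by rw [hY1 t ht h]; ring)
  · filter_upwards [hG.ae_mem, hshift L hL] with t ht hp
    have hle : t ≤ (t - L) + L := by linarith
    rcases hU t ht with h | h
    · rw [hY0 t ht h]
      exact Int.ofNat_le.2
        ((hZ _ _).1 (((hZ _ t).2 le_rfl).back_of_zero hU hup hp ht hle h))
    · rw [hY1 t ht h]
      have hch := (hZ _ t).2 le_rfl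
      revert hch
      generalize Z t = k
      intro hch
      cases k with
      | zero => simp
      -- With value `1` at `t`, the last upward switch has no downward switch yet. The preceding `k`
      -- are already counted at `a`, where the value is `0`, so going back from `a` applies.
      | succ k =>
        obtain ⟨a, b, ha, hb, hc, hab, hbt, ha0, hb1⟩ := hch
        have := (hZ _ _).1 (hc.back_of_zero hU hup hp ha (by linarith) ha0)
        push_cast
        omega
  · filter_upwards [hshift l hl] with t hp
    have hle : t ≤ (t - l) + l := by linarith
    rcases hU _ hp with h | h
    · rw [hY0 _ hp h]
      have hch := (hZ _ t).2 le_rfl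
      revert hch
      generalize Z t = k
      intro hch
      cases k with
      | zero => simp; omega
      | succ k =>
        have := (hZ _ _).1 (hch.back_succ hdown hle)
        push_cast
        omega
    · rw [hY1 _ hp h]
      have := (hZ _ _).1 (((hZ _ t).2 le_rfl).back_to_one hdown hp hle h)
      omega
  · intro N hN hstep
    obtain ⟨v, rfl⟩ := hstep
    have hval : ∀ i : Fin N, ∀ t ∈ G, t ∈ gridCell T N i → rep (stepFun T N v) t = v i := by
      intro i t ht hti
      have hev := (hG.loc t ht).and (isOpen_Ioo.mem_nhds hti)
      obtain ⟨ε, hε, hball⟩ := Metric.eventually_nhds_iff.1 hev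
      obtain ⟨x, x1, x2, -, x4, x5⟩ := exists_mem_Ioo_of_ae
        (hG.ae_mem.and (rep_stepFun_gridCell hT v)) (show t < t + ε by linarith) (hsub ht).1
      have hx := hball (y := x) (by rw [Real.dist_eq, abs_lt]; constructor <;> linarith)
      rw [← hx.1 x4, x5 i hx.2]
    -- Within a cell `u` is constant on `G`, so the last pair of a chain cannot lie inside a single
    -- cell. Its upper point may therefore be moved to any point `s` of `G` in the cell.
    have hle : ∀ i : Fin N, ∀ s ∈ G, ∀ t ∈ G, s ∈ gridCell T N i → t ∈ gridCell T N i →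
        Z t ≤ Z s := by
      intro i s hs t ht hsi hti
      rw [← hZ]
      have hch := (hZ _ t).2 le_rfl
      revert hch
      generalize Z t = k
      intro hch
      cases k with
      | zero => trivial
      | succ k =>
        obtain ⟨a, b, ha, hb, hc, hab, hbt, ha0, hb1⟩ := hch
        by_cases hbs : b ≤ s
        · exact ⟨a, b, ha, hb, hc, hab, hbs, ha0, hb1⟩
        rw [not_le] at hbs
        have hbi : b ∈ gridCell T N i := ⟨hsi.1.trans hbs, hbt.trans_lt hti.2⟩
        have hs1 : rep (stepFun T N v) s = 1 := by
          rw [hval i s hs hsi, ← hval i b hb hbi, hb1]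
        refine ⟨a, s, ha, hs, hc, ?_, le_rfl, ha0, hs1⟩
        by_contra has
        rw [not_lt] at has
        have hai : a ∈ gridCell T N i := ⟨hsi.1.trans_le has, hab.trans hbi.2⟩
        rw [hval i a ha hai, ← hval i b hb hbi, hb1] at ha0
        exact one_ne_zero ha0
    have hex : ∀ i : Fin N, ∃ s ∈ G, s ∈ gridCell T N i := by
      intro i
      have hN' : (0 : ℝ) < N := Nat.cast_pos.2 hN
      have hd : 0 < T / N := by positivity
      have hlt : (i : ℝ) * (T / N) < ((i : ℝ) + 1) * (T / N) := by linarith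
      have hiT : (i : ℝ) * (T / N) < T := by
        have : (i : ℝ) < N := by exact_mod_cast i.2
        calc (i : ℝ) * (T / N) < N * (T / N) := by gcongr
          _ = T := by field_simp
      obtain ⟨s, h1, h2, -, h4⟩ := exists_mem_Ioo_of_ae hG.ae_mem hlt hiT
      exact ⟨s, h4, h1, h2⟩
    choose s hsG hsi using hex
    refine ⟨fun i => Z (s i), ?_⟩
    filter_upwards [hG.ae_mem] with t ht i hti
    have := le_antisymm (hle i (s i) (hsG i) t ht (hsi i) hti)
      (hle i t ht (s i) (hsG i) hti (hsi i))
    rw [this]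
    simp

end Dwell

end Switching

/-! ### Closed convex sets in Hilbert spaces -/

section Hilbert

open Filter Topology

variable {H : Type*} [NormedAddCommGroup H] [InnerProductSpace ℝ H]

/-- In a Hilbert space, almost minimal elements of decreasing convex sets form a Cauchy
sequence. -/
lemma exists_cauchySeq_of_antitone_convex {S : ℕ → Set H} (hconv : ∀ n, Convex ℝ (S n))
    (hanti : Antitone S) (hne : ∀ n, (S n).Nonempty) {R : ℝ} (hR : ∀ n, ∀ x ∈ S n, ‖x‖ ≤ R) :
    ∃ x : ℕ → H, (∀ n, x n ∈ S n) ∧ CauchySeq x := by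
  set d : ℕ → ℝ := fun n => sInf (norm '' S n) with hd
  have hbdd : ∀ n, BddBelow (norm '' S n) := fun n =>
    ⟨0, by rintro _ ⟨x, -, rfl⟩; exact norm_nonneg x⟩
  have hle : ∀ n, ∀ x ∈ S n, d n ≤ ‖x‖ := fun n x hx => csInf_le (hbdd n) ⟨x, hx, rfl⟩
  have hmono : Monotone d := fun m n h =>
    csInf_le_csInf (hbdd m) ((hne n).image _) (image_mono (hanti h))
  have hdR : ∀ n, d n ≤ R := fun n => by
    obtain ⟨x, hx⟩ := hne n
    exact (hle n x hx).trans (hR n x hx)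
  have hlim : Tendsto d atTop (𝓝 (⨆ n, d n)) :=
    tendsto_atTop_ciSup hmono ⟨R, by rintro _ ⟨n, rfl⟩; exact hdR n⟩
  set e := ⨆ n, d n with he
  have hde : ∀ n, d n ≤ e := fun n => hmono.ge_of_tendsto hlim n
  have hd0 : ∀ n, 0 ≤ d n := fun n =>
    le_csInf ((hne n).image _) (by rintro _ ⟨x, -, rfl⟩; exact norm_nonneg x)
  have hex : ∀ n : ℕ, ∃ x ∈ S n, ‖x‖ < d n + 1 / ((n : ℝ) + 1) := by
    intro n
    obtain ⟨_, ⟨x, hx, rfl⟩, h⟩ := exists_lt_of_csInf_lt ((hne n).image norm)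
      (show sInf (norm '' S n) < d n + 1 / ((n : ℝ) + 1) from
        lt_add_of_pos_right _ (by positivity))
    exact ⟨x, hx, h⟩
  choose x hx hxd using hex
  refine ⟨x, hx, cauchySeq_of_le_tendsto_0'
    (fun n : ℕ => √(4 * ((e + 1 / ((n : ℝ) + 1)) ^ 2 - d n ^ 2))) (fun n m hnm => ?_) ?_⟩
  · rw [dist_eq_norm]
    refine Real.le_sqrt_of_sq_le ?_
    -- The midpoint lies in `S n` and so has norm at least `d n`, whereas both `x n` and `x m` have
    -- norm at most `e + 1 / (n + 1)`.
    have hpar := parallelogram_law_with_norm ℝ (x n) (x m)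
    have hmid : (2⁻¹ : ℝ) • x n + (2⁻¹ : ℝ) • x m ∈ S n :=
      hconv n (hx n) (hanti hnm (hx m)) (by norm_num) (by norm_num) (by norm_num)
    have h1 := hle n _ hmid
    rw [← smul_add, norm_smul, Real.norm_of_nonneg (by norm_num)] at h1
    have hfrac : 1 / ((m : ℝ) + 1) ≤ 1 / ((n : ℝ) + 1) :=
      one_div_le_one_div_of_le (by positivity) (by
        have : (n : ℝ) ≤ m := Nat.cast_le.2 hnm
        linarith)
    have h2 : ‖x n‖ ≤ e + 1 / ((n : ℝ) + 1) := by linarith [hxd n, hde n]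
    have h3 : ‖x m‖ ≤ e + 1 / ((n : ℝ) + 1) := by linarith [hxd m, hde m]
    have h4 := pow_le_pow_left₀ (norm_nonneg _) h2 2
    have h5 := pow_le_pow_left₀ (norm_nonneg _) h3 2
    have h6 := pow_le_pow_left₀ (hd0 n) h1 2
    nlinarith
  · have h1 : Tendsto (fun n : ℕ => e + 1 / ((n : ℝ) + 1)) atTop (𝓝 (e + 0)) :=
      tendsto_one_div_add_atTop_nhds_zero_nat.const_add e
    have h2 := (((h1.pow 2).sub (hlim.pow 2)).const_mul 4).sqrt
    simpa using h2

/-- Projections of closed convex sets are closed, if the other component is bounded. -/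
lemma isClosed_image_zero [CompleteSpace H] {X : Set (Fin (1 + 1) → H)} (hc : Convex ℝ X)
    (hcl : IsClosed X) {R : ℝ} (hR : ∀ w ∈ X, ‖w 1‖ ≤ R) : IsClosed ((fun w => w 0) '' X) := by
  rw [← closure_subset_iff_isClosed]
  intro u hu
  -- The second components over balls shrinking to `u`: decreasing, convex and bounded. A Cauchy
  -- selection from them replaces a weak compactness argument.
  set S : ℕ → Set H := fun n => {z | ∃ w ∈ X, w 1 = z ∧ w 0 ∈ Metric.ball u (1 / ((n : ℝ) + 1))}
    with hS
  obtain ⟨z, hz, hcau⟩ := exists_cauchySeq_of_antitone_convex (S := S) (R := R) (fun n => by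
      rintro _ ⟨w, hw, rfl, hw0⟩ _ ⟨w', hw', rfl, hw0'⟩ a b ha hb hab
      exact ⟨a • w + b • w', hc hw hw' ha hb hab, rfl, convex_ball u _ hw0 hw0' ha hb hab⟩)
    (fun m n hmn => by
      rintro _ ⟨w, hw, rfl, hw0⟩
      refine ⟨w, hw, rfl, Metric.ball_subset_ball ?_ hw0⟩
      exact one_div_le_one_div_of_le (by positivity) (by
        have : (m : ℝ) ≤ n := Nat.cast_le.2 hmn
        linarith))
    (fun n => by
      obtain ⟨_, ⟨w, hw, rfl⟩, h⟩ := Metric.mem_closure_iff.1 hu (1 / ((n : ℝ) + 1))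
        (by positivity)
      exact ⟨w 1, w, hw, rfl, by rwa [Metric.mem_ball, dist_comm]⟩)
    (fun n => by rintro _ ⟨w, hw, rfl, -⟩; exact hR w hw)
  obtain ⟨y, hy⟩ := cauchySeq_tendsto_of_complete hcau
  choose w hwX hw1 hw0 using hz
  have h0 : Tendsto (fun n => w n 0) atTop (𝓝 u) := by
    rw [tendsto_iff_dist_tendsto_zero]
    exact squeeze_zero (fun _ => dist_nonneg) (fun n => (hw0 n).le)
      tendsto_one_div_add_atTop_nhds_zero_nat
  have hw : Tendsto w atTop (𝓝 ![u, y]) := by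
    rw [tendsto_pi_nhds]
    intro i
    fin_cases i
    · exact h0
    · exact hy.congr fun n => (hw1 n).symm
  exact ⟨![u, y], hcl.mem_of_tendsto hw (Eventually.of_forall hwX), rfl⟩

end Hilbert

/-! ### Solution sets of linear systems -/

section Solutions

open Filter Topology

variable {T : ℝ}

lemma isClosed_L2star (T : ℝ) : IsClosed (L2star T : Set (Lp ℝ 2 (halfLine T))) := by
  rw [← isSeqClosed_iff_isClosed]
  intro f g hf hfg
  obtain ⟨ns, -, hns⟩ := (tendstoInMeasure_of_tendsto_Lp hfg).exists_seq_tendsto_ae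
  have hall : ∀ᵐ t ∂(halfLine T), ∀ n, t < 0 → f n t = 0 := ae_all_iff.2 hf
  filter_upwards [hns, hall] with t h1 h2 ht
  refine tendsto_nhds_unique h1 ?_
  simp only [h2 _ ht, tendsto_const_nhds]

instance (T : ℝ) : CompleteSpace (L2star T) := (isClosed_L2star T).completeSpace_coe

lemma isClosed_nonneg_values : IsClosed {u : L2star T | ValuesIn u (Ici 0)} := by
  have : {u : L2star T | ValuesIn u (Ici 0)} =
      (fun u : L2star T => (u : Lp ℝ 2 (halfLine T))) ⁻¹' Ici 0 := by
    ext u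
    rw [mem_preimage, mem_Ici, ← Lp.coeFn_nonneg]
    exact valuesIn_iff_of_zero_mem (by simp)
  rw [this]
  exact isClosed_Ici.preimage continuous_subtype_val

lemma convex_nonneg_values : Convex ℝ {u : L2star T | ValuesIn u (Ici 0)} := by
  intro u hu v hv a b ha hb _
  simp only [mem_ofPred_eq, valuesIn_iff] at hu hv ⊢
  filter_upwards [hu, hv, rep_add (a • u) (b • v), rep_smul a u, rep_smul b v]
    with t h1 h2 h3 h4 h5 ht
  rw [h3, h4, h5]
  exact add_nonneg (mul_nonneg ha (h1 ht)) (mul_nonneg hb (h2 ht))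

/-- It exhibits `Du ≥ 0` as an intersection of closed half-spaces. -/
lemma IsTestFun.distribDeriv_eq_inner {φ : ℝ → ℝ} (hφ : IsTestFun T φ) (u : L2star T) :
    distribDeriv u φ = -inner ℝ (hφ.memLp_deriv.toLp _) (u : Lp ℝ 2 (halfLine T)) := by
  rw [distribDeriv, L2.inner_def]
  congr 1
  refine integral_congr_ae ?_
  filter_upwards [hφ.memLp_deriv.coeFn_toLp] with t ht
  rw [ht]
  simp [rep]

lemma isClosed_derivNonneg : IsClosed {u : L2star T | DerivNonneg u} := by
  simp only [DerivNonneg, ofPred_forall]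
  refine isClosed_iInter fun φ => isClosed_iInter fun hφ => isClosed_iInter fun _ => ?_
  simp only [hφ.distribDeriv_eq_inner]
  exact isClosed_le continuous_const (continuous_const.inner continuous_subtype_val).neg

lemma convex_derivNonneg : Convex ℝ {u : L2star T | DerivNonneg u} := by
  intro u hu v hv a b ha hb _ φ hφ hpos
  have h1 := hu φ hφ hpos
  have h2 := hv φ hφ hpos
  rw [hφ.distribDeriv_eq_inner] at h1 h2 ⊢
  rw [Submodule.coe_add, Submodule.coe_smul, Submodule.coe_smul, inner_add_right,
    inner_smul_right_eq_smul, inner_smul_right_eq_smul, smul_eq_mul, smul_eq_mul]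
  nlinarith [mul_nonneg ha h1, mul_nonneg hb h2]

lemma LinConstraint.isClosed {d : ℕ} (K : LinConstraint T d) : IsClosed {w | K.Holds w} := by
  obtain ⟨F, _ | _⟩ := K
  · exact isClosed_nonneg_values.preimage F.continuous
  · exact isClosed_derivNonneg.preimage F.continuous

lemma LinConstraint.convex {d : ℕ} (K : LinConstraint T d) : Convex ℝ {w | K.Holds w} := by
  obtain ⟨F, _ | _⟩ := K
  · exact convex_nonneg_values.affine_preimage F.toAffineMap
  · exact convex_derivNonneg.affine_preimage F.toAffineMap

lemma LinSystem.isClosed_solutions {d : ℕ} (A : LinSystem T d) : IsClosed A.solutions := by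
  simp only [LinSystem.solutions, ofPred_forall]
  exact isClosed_iInter fun k => (A.con k).isClosed

lemma LinSystem.convex_solutions {d : ℕ} (A : LinSystem T d) : Convex ℝ A.solutions := by
  simp only [LinSystem.solutions, ofPred_forall]
  exact convex_iInter fun k => (A.con k).convex

lemma norm_le_of_ae_bound (hT : 0 < T) {u : L2star T} {C : ℝ}
    (h : ∀ᵐ t ∂(halfLine T), |rep u t| ≤ C) : ‖u‖ ≤ C * ‖unitFun T‖ := by
  refine Lp.norm_le_mul_norm_of_ae_le_mul (f := (u : Lp ℝ 2 (halfLine T)))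
    (g := (unitFun T : Lp ℝ 2 (halfLine T))) ?_
  filter_upwards [h, rep_unitFun hT, rep_eq_zero_of_neg u, rep_eq_zero_of_neg (unitFun T),
    ae_ne_zero (T := T)] with t h1 h2 h3 h4 h5
  change ‖rep u t‖ ≤ C * ‖rep (unitFun T) t‖
  rcases lt_or_gt_of_ne h5 with ht | ht
  · simp [h3 ht, h4 ht]
  · rw [h2 ht]
    simpa using h1

end Solutions

/-! ### Averages of roundings -/

section Rounding

variable {T : ℝ}

/-- Raising `m` by `1` moves a window of `n` consecutive numerators by one place; the entry gained
exceeds the entry lost by exactly `n`, so the sum of quotients grows by `1`. -/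
lemma sum_int_add_div (n : ℕ) (hn : 0 < n) (m : ℤ) :
    ∑ k ∈ Finset.range n, (m + (k : ℤ)) / (n : ℤ) = m := by
  have hn' : (n : ℤ) ≠ 0 := by omega
  have hstep : ∀ m : ℤ, ∑ k ∈ Finset.range n, (m + 1 + (k : ℤ)) / (n : ℤ) =
      ∑ k ∈ Finset.range n, (m + (k : ℤ)) / (n : ℤ) + 1 := by
    intro m
    have h1 := Finset.sum_range_succ' (fun k : ℕ => (m + (k : ℤ)) / (n : ℤ)) n
    rw [Finset.sum_range_succ, Int.add_ediv_of_dvd_right (dvd_refl _), Int.ediv_self hn'] at h1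
    have h2 : ∑ k ∈ Finset.range n, (m + 1 + (k : ℤ)) / (n : ℤ) =
        ∑ k ∈ Finset.range n, (m + ((k + 1 : ℕ) : ℤ)) / (n : ℤ) := by
      refine Finset.sum_congr rfl fun k _ => ?_
      push_cast
      ring_nf
    rw [h2]
    simp only [Nat.cast_zero, add_zero] at h1
    omega
  induction m using Int.induction_on with
  | zero =>
    refine Finset.sum_eq_zero fun k hk => ?_
    rw [zero_add]
    exact Int.ediv_eq_zero_of_lt (by omega) (by exact_mod_cast Finset.mem_range.1 hk)
  | succ m ih => rw [hstep, ih]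
  | pred m ih =>
    have := hstep (-(m : ℤ) - 1)
    rw [sub_add_cancel, ih] at this
    omega

/-- Hermite's identity. -/
lemma sum_floor_add_div (n : ℕ) (hn : 0 < n) (x : ℝ) :
    ∑ k ∈ Finset.range n, ⌊x + (k : ℝ) / n⌋ = ⌊n * x⌋ := by
  rw [← sum_int_add_div n hn ⌊n * x⌋]
  refine Finset.sum_congr rfl fun k _ => ?_
  have hn' : (n : ℝ) ≠ 0 := by positivity
  rw [← Int.floor_add_natCast, ← Int.floor_div_natCast]
  congr 1
  field_simp

/-- By Hermite's identity the average equals `⌊n x⌋ / n`. -/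
lemma abs_average_floor_sub_le (n : ℕ) (hn : 0 < n) (x : ℝ) :
    |(n : ℝ)⁻¹ * ∑ k ∈ Finset.range n, (⌊x + (k : ℝ) / n⌋ : ℝ) - x| ≤ (n : ℝ)⁻¹ := by
  have hn' : (0 : ℝ) < n := Nat.cast_pos.2 hn
  have h := sum_floor_add_div n hn x
  have h' : ∑ k ∈ Finset.range n, (⌊x + (k : ℝ) / n⌋ : ℝ) = ⌊n * x⌋ := by exact_mod_cast h
  rw [h']
  have e : (n : ℝ)⁻¹ * (⌊n * x⌋ : ℝ) - x = (n : ℝ)⁻¹ * ((⌊n * x⌋ : ℝ) - n * x) := by field_simp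
  rw [e, abs_mul, abs_of_pos (inv_pos.2 hn')]
  refine mul_le_of_le_one_right (inv_pos.2 hn').le ?_
  rw [abs_le]
  constructor
  · linarith [Int.lt_floor_add_one (n * x)]
  · linarith [Int.floor_le (n * x)]

lemma rep_sum {ι : Type*} (s : Finset ι) (r : ι → L2star T) :
    rep (∑ k ∈ s, r k) =ᵐ[halfLine T] fun t => ∑ k ∈ s, rep (r k) t := by
  classical
  induction s using Finset.induction_on with
  | empty =>
    simp only [Finset.sum_empty]
    exact Lp.coeFn_zero ℝ 2 (halfLine T)
  | insert a s ha ih =>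
    rw [Finset.sum_insert ha]
    filter_upwards [rep_add (r a) (∑ k ∈ s, r k), ih] with t h1 h2
    rw [h1, h2, Finset.sum_insert ha]

/-- A control all of whose roundings lie in `S` lies in the closed convex hull of `S`. -/
lemma mem_closure_convexHull_of_rounding (hT : 0 < T) {S : Set (L2star T)} {u z : L2star T}
    (h : ∀ θ ∈ Ico (0 : ℝ) 1, ∃ r ∈ S, rep r =ᵐ[halfLine T]
      fun t => (⌊rep z t + θ⌋ : ℝ) - ⌊rep z t - rep u t + θ⌋) :
    u ∈ closure (convexHull ℝ S) := by
  rw [Metric.mem_closure_iff]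
  intro ε hε
  -- The roundings of `z` and of `z - u` each contribute an error of at most `1/n`, so `n` must
  -- exceed `2 ‖1‖ / ε`.
  obtain ⟨n, hn⟩ := exists_nat_gt (max 1 (2 * ‖unitFun T‖ / ε))
  rw [max_lt_iff] at hn
  have hn0 : (0 : ℝ) < n := by linarith [hn.1]
  have hnpos : 0 < n := by exact_mod_cast hn0
  choose r hrS hr using h
  have hθ : ∀ k : Fin n, (k : ℝ) / n ∈ Ico (0 : ℝ) 1 := fun k =>
    ⟨by positivity, by rw [div_lt_one hn0]; exact_mod_cast k.2⟩
  set ρ : Fin n → L2star T := fun k => r _ (hθ k) with hρ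
  refine ⟨∑ k : Fin n, (n : ℝ)⁻¹ • ρ k, ?_, ?_⟩
  · refine (convex_convexHull ℝ S).sum_mem (fun _ _ => by positivity) ?_
      fun k _ => subset_convexHull ℝ S (hrS _ (hθ k))
    simp [hn0.ne']
  · rw [dist_comm, dist_eq_norm]
    refine lt_of_le_of_lt (norm_le_of_ae_bound hT (C := 2 * (n : ℝ)⁻¹) ?_) ?_
    · have hall : ∀ᵐ t ∂(halfLine T), ∀ k : Fin n, rep (ρ k) t =
          (⌊rep z t + (k : ℝ) / n⌋ : ℝ) - ⌊rep z t - rep u t + (k : ℝ) / n⌋ :=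
        ae_all_iff.2 fun k => hr _ (hθ k)
      have hsm : ∀ᵐ t ∂(halfLine T), ∀ k : Fin n, rep ((n : ℝ)⁻¹ • ρ k) t =
          (n : ℝ)⁻¹ * rep (ρ k) t := ae_all_iff.2 fun k => rep_smul _ _
      filter_upwards [hall, hsm, rep_sum Finset.univ fun k : Fin n => (n : ℝ)⁻¹ • ρ k,
        rep_sub (∑ k : Fin n, (n : ℝ)⁻¹ • ρ k) u] with t h1 h2 h3 h4
      rw [h4, h3]
      simp only [h2, h1]
      rw [← Finset.mul_sum, Finset.sum_sub_distrib,
        Fin.sum_univ_eq_sum_range (fun k => (⌊rep z t + (k : ℝ) / n⌋ : ℝ)),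
        Fin.sum_univ_eq_sum_range (fun k => (⌊rep z t - rep u t + (k : ℝ) / n⌋ : ℝ))]
      have b1 := abs_le.1 (abs_average_floor_sub_le n hnpos (rep z t))
      have b2 := abs_le.1 (abs_average_floor_sub_le n hnpos (rep z t - rep u t))
      rw [mul_sub, abs_le]
      constructor <;> linarith [b1.1, b1.2, b2.1, b2.2]
    · have := hn.2
      rw [div_lt_iff₀ hε] at this
      calc 2 * (n : ℝ)⁻¹ * ‖unitFun T‖ = (2 * ‖unitFun T‖) * (n : ℝ)⁻¹ := by ring
        _ < (n * ε) * (n : ℝ)⁻¹ := by gcongr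
        _ = ε := by field_simp

end Rounding

/-! ### The extended formulation -/

lemma Monotone.eq_zero_of_ae {T : ℝ} (hT : 0 < T) {f : ℝ → ℝ} (hf : Monotone f)
    (h : ∀ᵐ t ∂(halfLine T), t < 0 → f t = 0) : ∀ t < 0, f t = 0 := by
  intro t ht
  obtain ⟨a, -, a2, -, a4⟩ := exists_mem_Ioo_of_ae h (show t - 1 < t by linarith) (by linarith)
  obtain ⟨b, b1, b2, -, b4⟩ := exists_mem_Ioo_of_ae h ht (by linarith)
  have h1 := hf a2.le
  have h2 := hf b1.le
  rw [a4 (a2.trans ht)] at h1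
  rw [b4 b2] at h2
  exact le_antisymm h2 h1

lemma Monotone.le_of_ae {T : ℝ} {f : ℝ → ℝ} (hf : Monotone f) {C : ℝ}
    (h : ∀ᵐ t ∂(halfLine T), f t ≤ C) : ∀ t < T, f t ≤ C := by
  intro t ht
  obtain ⟨b, b1, -, -, b4⟩ := exists_mem_Ioo_of_ae h ht ht
  exact (hf b1.le).trans b4

/-- The two dwell-time inequalities combine to at most one upward switch per time `L + l`; iteration
gives the bound that justifies `σ`. -/
lemma IsSwitchingPair.le_add {T L l : ℝ} {u : L2star T} {Z Y : ℝ → ℤ} {C : ℕ}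
    (h : IsSwitchingPair L l u Z Y C) (hL : 0 ≤ L) (hl : 0 ≤ l) (n : ℕ) :
    ∀ᵐ t ∂(halfLine T), Z t ≤ n + Z (t - n * (L + l)) := by
  induction n with
  | zero => simp
  | succ n ih =>
    filter_upwards [ae_shift (add_nonneg hL hl) ih, h.down, ae_shift hl h.up] with t h1 h2 h3
    have e1 : t - l - L = t - (L + l) := by ring
    have e2 : t - (L + l) - n * (L + l) = t - ((n + 1 : ℕ) : ℝ) * (L + l) := by push_cast; ring
    rw [e1] at h3
    rw [e2] at h1
    push_cast at h1 ⊢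
    omega

namespace DwellInput

variable (I : DwellInput)

lemma T_pos_real : (0 : ℝ) < I.T := Rat.cast_pos.2 I.T_pos

lemma L_nonneg_real : (0 : ℝ) ≤ I.L := Rat.cast_nonneg.2 I.L_nonneg

lemma l_nonneg_real : (0 : ℝ) ≤ I.l := Rat.cast_nonneg.2 I.l_nonneg

lemma sigma_nonneg : 0 ≤ I.sigma := by
  have := I.T_pos
  have := I.add_pos
  exact Int.ceil_nonneg (by positivity)

lemma two_mul_T_le : 2 * (I.T : ℝ) ≤ I.sigma * ((I.L : ℝ) + I.l) := by
  have h : 2 * I.T / (I.L + I.l) ≤ (I.sigma : ℚ) := Int.le_ceil _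
  rw [div_le_iff₀ I.add_pos] at h
  exact_mod_cast h

/-- The constraints of the extended formulation in terms of representatives. -/
lemma mem_ext_iff (w : Fin (1 + 1) → L2star (I.T : ℝ)) : w ∈ I.ext ↔
    (∀ᵐ t ∂(halfLine (I.T : ℝ)), 0 ≤ rep (w 0) t ∧ rep (w 0) t ≤ 1) ∧
    (∀ᵐ t ∂(halfLine (I.T : ℝ)), 0 ≤ rep (w 1) t ∧ rep (w 1) t ≤ I.sigma) ∧
    (∀ᵐ t ∂(halfLine (I.T : ℝ)), rep (w 1) t - rep (w 0) t ≤ rep (w 1) (t - I.L)) ∧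
    (∀ᵐ t ∂(halfLine (I.T : ℝ)),
      rep (w 1) t ≤ 1 + (rep (w 1) (t - I.l) - rep (w 0) (t - I.l))) ∧
    DerivNonneg (w 1 - w 0) ∧ DerivNonneg (w 1) := by
  have hσ : (0 : ℝ) ≤ I.sigma := Int.cast_nonneg I.sigma_nonneg
  have hneg0 := rep_eq_zero_of_neg (w 0)
  have hneg1 := rep_eq_zero_of_neg (w 1)
  refine and_congr (valuesIn_iff_of_zero_mem ⟨le_rfl, zero_le_one⟩) (and_congr
    (valuesIn_iff_of_zero_mem ⟨le_rfl, hσ⟩) (and_congr ?_ (and_congr ?_ Iff.rfl)))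
  · rw [ae_Ioo_iff]
    have hs := rep_shift I.L_nonneg_real (w 1)
    constructor
    · intro h
      filter_upwards [h, hs, hneg0, hneg1, ae_shift I.L_nonneg_real hneg1, ae_ne_zero]
        with t h1 h2 h3 h4 h5 h6
      rcases lt_or_gt_of_ne h6 with ht | ht
      · rw [h3 ht, h4 ht, h5 (by linarith [I.L_nonneg_real]), sub_zero]
      · have := h1 ht
        rw [h2] at this
        linarith
    · intro h
      filter_upwards [h, hs] with t h1 h2 _
      rw [h2]
      linarith
  · rw [ae_Ioo_iff]
    have hs0 := rep_shift I.l_nonneg_real (w 0)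
    have hs1 := rep_shift I.l_nonneg_real (w 1)
    constructor
    · intro h
      filter_upwards [h, hs0, hs1, hneg1, ae_shift I.l_nonneg_real hneg0,
        ae_shift I.l_nonneg_real hneg1, ae_ne_zero] with t h1 h2 h3 h4 h5 h6 h7
      rcases lt_or_gt_of_ne h7 with ht | ht
      · have := I.l_nonneg_real
        rw [h4 ht, h5 (by linarith), h6 (by linarith)]
        norm_num
      · have := h1 ht
        rw [h2, h3] at this
        linarith
    · intro h
      filter_upwards [h, hs0, hs1] with t h1 h2 h3 _
      rw [h2, h3]
      linarith

variable {I}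

/-- The roundings of an element of the extended formulation are feasible controls. -/
lemma exists_rounding {w : Fin (1 + 1) → L2star (I.T : ℝ)} (hw : w ∈ I.ext) {θ : ℝ}
    (hθ : θ ∈ Ico (0 : ℝ) 1) :
    ∃ r ∈ dwellSet (I.T : ℝ) I.L I.l, rep r =ᵐ[halfLine (I.T : ℝ)]
      fun t => (⌊rep (w 1) t + θ⌋ : ℝ) - ⌊rep (w 1) t - rep (w 0) t + θ⌋ := by
  rw [mem_ext_iff] at hw
  obtain ⟨hu, hz, hup, hdown, hDy, hDz⟩ := hw
  have hσ : (0 : ℝ) ≤ I.sigma := Int.cast_nonneg I.sigma_nonneg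
  have hy := rep_sub (w 1) (w 0)
  obtain ⟨f, hf, hfe⟩ := hDz.exists_monotone (C := I.sigma) (by
    filter_upwards [hz] with t ht
    rw [abs_of_nonneg ht.1]
    exact ht.2)
  obtain ⟨g, hg, hge⟩ := hDy.exists_monotone (C := I.sigma + 1) (by
    filter_upwards [hz, hu, hy] with t h1 h2 h3
    rw [h3, abs_le]
    constructor <;> linarith [h1.1, h1.2, h2.1, h2.2])
  have hge' : (fun t => rep (w 1) t - rep (w 0) t) =ᵐ[halfLine (I.T : ℝ)] g := hy.symm.trans hge
  have hf0 : ∀ t < 0, f t = 0 := hf.eq_zero_of_ae I.T_pos_real (by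
    filter_upwards [hfe, rep_eq_zero_of_neg (w 1)] with t h1 h2 ht
    rw [← h1, h2 ht])
  have hg0 : ∀ t < 0, g t = 0 := hg.eq_zero_of_ae I.T_pos_real (by
    filter_upwards [hge', rep_eq_zero_of_neg (w 1), rep_eq_zero_of_neg (w 0)] with t h1 h2 h3 ht
    rw [← h1, h2 ht, h3 ht, sub_zero])
  have hfC : ∀ t < (I.T : ℝ), f t ≤ I.sigma := hf.le_of_ae (by
    filter_upwards [hfe, hz] with t h1 h2
    rw [← h1]
    exact h2.2)
  have hgC : ∀ t < (I.T : ℝ), g t ≤ I.sigma := hg.le_of_ae (by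
    filter_upwards [hge', hz, hu] with t h1 h2 h3
    rw [← h1]
    linarith [h2.2, h3.1])
  -- Since `0 ≤ θ < 1`, the floor of `θ` is `0`, so the rounded monotone representatives still
  -- vanish on the negative axis. The remaining conditions hold because the floor is monotone and
  -- commutes with adding `1`.
  set Z : ℝ → ℤ := fun t => ⌊f t + θ⌋ with hZ
  set Y : ℝ → ℤ := fun t => ⌊g t + θ⌋ with hY
  have hfloor0 : ⌊θ⌋ = 0 := Int.floor_eq_zero_iff.2 hθ
  have hval : ∀ᵐ t ∂(halfLine (I.T : ℝ)), Z t = Y t ∨ Z t = Y t + 1 := by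
    filter_upwards [hfe, hge', hu] with t h1 h2 h3
    have h4 : Y t ≤ Z t := Int.floor_le_floor (by rw [← h1, ← h2]; linarith [h3.1])
    have h5 : Z t ≤ Y t + 1 := by
      simp only [hZ, hY]
      rw [← Int.floor_add_one]
      exact Int.floor_le_floor (by rw [← h1, ← h2]; linarith [h3.2])
    omega
  have hmZ : Monotone Z := fun s t h => Int.floor_le_floor (by linarith [hf h])
  have hmY : Monotone Y := fun s t h => Int.floor_le_floor (by linarith [hg h])
  have hbound : ∀ x : ℝ, x ≤ I.sigma → ⌊x + θ⌋ ≤ ((I.sigma.toNat + 1 : ℕ) : ℤ) := by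
    intro x hx
    have h1 : ⌊x + θ⌋ ≤ ⌊(I.sigma : ℝ) + 1⌋ := Int.floor_le_floor (by linarith [hθ.2])
    rw [Int.floor_add_one, Int.floor_intCast] at h1
    have := I.sigma_nonneg
    omega
  have hmeas : AEStronglyMeasurable (fun t => (Z t : ℝ) - Y t) (halfLine (I.T : ℝ)) := by
    have h1 : Monotone fun t => (Z t : ℝ) := fun s t h => Int.cast_le.2 (hmZ h)
    have h2 : Monotone fun t => (Y t : ℝ) := fun s t h => Int.cast_le.2 (hmY h)
    exact (h1.measurable.sub h2.measurable).aestronglyMeasurable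
  have hZ0 : ∀ t < 0, Z t = 0 := fun t ht => by simp only [hZ, hf0 t ht, zero_add, hfloor0]
  have hY0 : ∀ t < 0, Y t = 0 := fun t ht => by simp only [hY, hg0 t ht, zero_add, hfloor0]
  obtain ⟨r, hr⟩ := exists_rep_eq (C := 1) hmeas
    (Filter.Eventually.of_forall fun t ht => by simp [hZ0 t ht, hY0 t ht]) (by
      filter_upwards [hval] with t ht
      rcases ht with ht | ht <;> simp [ht])
  refine ⟨r, IsSwitchingPair.mem_dwellSet (Z := Z) (Y := Y) (C := I.sigma.toNat + 1)
    ⟨hmZ, hmY, hZ0, hY0, fun t ht => hbound _ (hfC t ht), fun t ht => hbound _ (hgC t ht), hr,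
      hval, ?_, ?_⟩, ?_⟩
  · filter_upwards [hup, hge', ae_shift I.L_nonneg_real hfe] with t h1 h2 h3
    exact Int.floor_le_floor (by rw [← h2, ← h3]; linarith)
  · filter_upwards [hdown, hfe, ae_shift I.l_nonneg_real hge'] with t h1 h2 h3
    simp only [hZ, hY]
    rw [add_comm (1 : ℤ), ← Int.floor_add_one]
    exact Int.floor_le_floor (by rw [← h2, ← h3]; linarith)
  · filter_upwards [hr, hfe, hge'] with t h1 h2 h3
    rw [h1, h3, h2]

/-- Feasible controls are projections of elements of the extended formulation, which can be
chosen piecewise constant if the control is. -/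
lemma exists_mem_ext {u : L2star (I.T : ℝ)} (hu : u ∈ dwellSet (I.T : ℝ) I.L I.l) :
    ∃ w ∈ I.ext, w 0 = u ∧ ∀ N, 0 < N → u ∈ stepSpace (I.T : ℝ) N →
      w 1 ∈ stepSpace (I.T : ℝ) N := by
  obtain ⟨Z, Y, C, h, hstep⟩ :=
    exists_isSwitchingPair I.T_pos_real I.L_nonneg_real I.l_nonneg_real hu
  have hZpos := h.monoZ.int_nonneg h.zeroZ
  have hmZ : Monotone fun t => (Z t : ℝ) := fun s t hst => Int.cast_le.2 (h.monoZ hst)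
  obtain ⟨z, hz⟩ := exists_rep_eq (T := (I.T : ℝ)) (C := C) hmZ.measurable.aestronglyMeasurable
    (Filter.Eventually.of_forall fun t ht => by simp [h.zeroZ t ht]) (by
      filter_upwards [ae_restrict_mem (measurableSet_Iio (a := (I.T : ℝ)))] with t ht
      rw [abs_of_nonneg (Int.cast_nonneg (hZpos t))]
      exact_mod_cast h.leZ t ht)
  refine ⟨![u, z], (mem_ext_iff I _).2 ?_, rfl, fun N hN hN' => ?_⟩
  · simp only [Matrix.cons_val_zero, Matrix.cons_val_one]
    have hd : rep (z - u) =ᵐ[halfLine (I.T : ℝ)] fun t => (Y t : ℝ) := by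
      filter_upwards [rep_sub z u, hz, h.rep_eq] with t h1 h2 h3
      rw [h1, h2, h3]
      ring
    refine ⟨?_, ?_, ?_, ?_, derivNonneg_of_int_monotone h.monoY h.zeroY h.leY hd,
      derivNonneg_of_int_monotone h.monoZ h.zeroZ h.leZ hz⟩
    · filter_upwards [h.rep_eq, h.values] with t h1 h2
      rw [h1]
      rcases h2 with h2 | h2 <;> simp [h2]
    · filter_upwards [hz, h.le_add I.L_nonneg_real I.l_nonneg_real I.sigma.toNat,
        ae_restrict_mem (measurableSet_Iio (a := (I.T : ℝ)))] with t h1 h2 h3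
      rw [h1]
      refine ⟨Int.cast_nonneg (hZpos t), ?_⟩
      have hcast : ((I.sigma.toNat : ℕ) : ℝ) = I.sigma := by
        have := Int.toNat_of_nonneg I.sigma_nonneg
        exact_mod_cast this
      have h4 := I.two_mul_T_le
      have h5 := I.T_pos_real
      have h6 : t < I.T := h3
      -- After `σ` periods of length `L + l` one is left of `0`, where nothing has been counted: `σ
      -- (L + l) ≥ 2T > t`.
      rw [hcast, h.zeroZ (t - I.sigma * ((I.L : ℝ) + I.l)) (by linarith), add_zero, Int.toNat_of_nonneg I.sigma_nonneg] at h2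
      exact_mod_cast h2
    · filter_upwards [hz, h.rep_eq, h.up, ae_shift I.L_nonneg_real hz] with t h1 h2 h3 h4
      rw [h1, h2, h4]
      have : (Y t : ℝ) ≤ Z (t - I.L) := by exact_mod_cast h3
      linarith
    · filter_upwards [hz, h.down, ae_shift I.l_nonneg_real hz,
        ae_shift I.l_nonneg_real h.rep_eq] with t h1 h2 h3 h4
      rw [h1, h3, h4]
      have : (Z t : ℝ) ≤ 1 + Y (t - I.l) := by exact_mod_cast h2
      linarith
  · obtain ⟨v, hv⟩ := hstep N hN hN'
    refine mem_stepSpace_of_ae I.T_pos_real hN v ?_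
    filter_upwards [hv, hz] with t h1 h2 i hi
    rw [← h1 i hi]
    exact h2

end DwellInput

/-! ### The system of constraints -/

lemma ShiftCoeffs.holds_iff {T L l : ℝ} (hT : 0 < T) (hL : 0 ≤ L) (hl : 0 ≤ l) (K : ShiftCoeffs)
    (w : Fin (1 + 1) → L2star T) :
    (LinConstraint.mk (K.op T hL hl) false).Holds w ↔
      ∀ᵐ t ∂(volume.restrict (Ioo 0 T)), 0 ≤ K.u * rep (w 0) t + K.z * rep (w 1) t +
        K.zL * rep (shift T L hL (w 1)) t + K.ul * rep (shift T l hl (w 0)) t +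
        K.zl * rep (shift T l hl (w 1)) t + K.one := by
  refine Filter.eventually_congr ?_
  filter_upwards [ae_Ioo_iff.2 (K.rep_op hT hL hl w)] with t ht
  rw [← ht]
  rfl

namespace DwellInput

variable (I : DwellInput)

/-- The coefficients of the constraints that describe the extended formulation. -/
def coeffs : Fin 8 → ShiftCoeffs :=
  ![⟨1, 0, 0, 0, 0, 0⟩, ⟨-1, 0, 0, 0, 0, 1⟩, ⟨0, 1, 0, 0, 0, 0⟩, ⟨0, -1, 0, 0, 0, I.sigma⟩,
    ⟨1, -1, 1, 0, 0, 0⟩, ⟨0, -1, 0, -1, 1, 1⟩, ⟨-1, 1, 0, 0, 0, 0⟩, ⟨0, 1, 0, 0, 0, 0⟩]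

/-- The constraints that describe the extended formulation; the last two are constraints on
derivatives. -/
noncomputable def constraint (k : Fin 8) : LinConstraint (I.T : ℝ) 1 :=
  ⟨(I.coeffs k).op I.T I.L_nonneg_real I.l_nonneg_real,
    ![false, false, false, false, false, false, true, true] k⟩

/-- The linear system that describes the extended formulation. -/
noncomputable def system : LinSystem (I.T : ℝ) 1 := ⟨8, I.constraint⟩

lemma ext_eq_solutions : I.ext = I.system.solutions := by
  ext w
  have hop := fun k : Fin 8 => (I.coeffs k).holds_iff I.T_pos_real I.L_nonneg_real
    I.l_nonneg_real w
  have h6 : (I.constraint 6).Holds w ↔ DerivNonneg (w 1 - w 0) := by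
    have : (I.constraint 6).op w = w 1 - w 0 := by
      simp [constraint, coeffs, ShiftCoeffs.op_apply]
      abel
    rw [← this]
    rfl
  have h7 : (I.constraint 7).Holds w ↔ DerivNonneg (w 1) := by
    have : (I.constraint 7).op w = w 1 := by
      simp [constraint, coeffs, ShiftCoeffs.op_apply]
    rw [← this]
    rfl
  have hsol : w ∈ I.system.solutions ↔ ∀ k : Fin 8, (I.constraint k).Holds w := Iff.rfl
  have hall : ∀ P : Fin 8 → Prop, (∀ k, P k) ↔
      (P 0 ∧ P 1) ∧ (P 2 ∧ P 3) ∧ P 4 ∧ P 5 ∧ P 6 ∧ P 7 := by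
    intro P
    constructor
    · intro h
      exact ⟨⟨h 0, h 1⟩, ⟨h 2, h 3⟩, h 4, h 5, h 6, h 7⟩
    · rintro ⟨⟨h0, h1⟩, ⟨h2, h3⟩, h4, h5, h6, h7⟩ k
      fin_cases k <;> assumption
  rw [hsol, hall fun k => (I.constraint k).Holds w, h6, h7]
  have e0 := hop 0
  have e1 := hop 1
  have e2 := hop 2
  have e3 := hop 3
  have e4 := hop 4
  have e5 := hop 5
  simp only [coeffs, Matrix.cons_val] at e0 e1 e2 e3 e4 e5
  refine and_congr ?_ (and_congr ?_ (and_congr ?_ (and_congr ?_ Iff.rfl)))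
  · refine Iff.trans ?_ (and_congr e0 e1).symm
    rw [← Filter.eventually_and]
    refine Filter.eventually_congr (Filter.Eventually.of_forall fun t => ?_)
    push_cast
    constructor
    · rintro ⟨h1, h2⟩
      constructor <;> linarith
    · rintro ⟨h1, h2⟩
      constructor <;> linarith
  · refine Iff.trans ?_ (and_congr e2 e3).symm
    rw [← Filter.eventually_and]
    refine Filter.eventually_congr (Filter.Eventually.of_forall fun t => ?_)
    push_cast
    constructor
    · rintro ⟨h1, h2⟩
      constructor <;> linarith
    · rintro ⟨h1, h2⟩
      constructor <;> linarith
  · refine Iff.trans ?_ e4.symm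
    refine Filter.eventually_congr (Filter.Eventually.of_forall fun t => ?_)
    push_cast
    constructor <;> intro h <;> linarith
  · refine Iff.trans ?_ e5.symm
    refine Filter.eventually_congr (Filter.Eventually.of_forall fun t => ?_)
    push_cast
    constructor <;> intro h <;> linarith

lemma convex_ext : Convex ℝ I.ext := by
  rw [ext_eq_solutions]
  exact I.system.convex_solutions

lemma isClosed_projFirst_ext : IsClosed (projFirst I.ext) := by
  refine isClosed_image_zero I.convex_ext (by
    rw [ext_eq_solutions]; exact I.system.isClosed_solutions)
    (R := I.sigma * ‖unitFun (I.T : ℝ)‖) fun w hw => norm_le_of_ae_bound I.T_pos_real ?_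
  filter_upwards [((mem_ext_iff I w).1 hw).2.1] with t ht
  rw [abs_of_nonneg ht.1]
  exact ht.2

lemma convex_projFirst {T : ℝ} {d : ℕ} {X : Set (Fin (d + 1) → L2star T)} (hX : Convex ℝ X) :
    Convex ℝ (projFirst X) :=
  hX.linear_image (LinearMap.proj 0 : (Fin (d + 1) → L2star T) →ₗ[ℝ] L2star T)

/-- One inclusion is rounding. For the other, the projection is closed and convex, so it suffices to
lift single feasible controls. -/
lemma projFirst_ext : projFirst I.ext = closure (convexHull ℝ (dwellSet (I.T : ℝ) I.L I.l)) := by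
  refine Subset.antisymm ?_ (closure_minimal (convexHull_min ?_ (convex_projFirst I.convex_ext))
    I.isClosed_projFirst_ext)
  · rintro _ ⟨w, hw, rfl⟩
    exact mem_closure_convexHull_of_rounding I.T_pos_real fun θ hθ => exists_rounding hw hθ
  · intro u hu
    obtain ⟨w, hw, h0, -⟩ := exists_mem_ext hu
    exact ⟨w, hw, h0⟩

/-- Finiteness makes the convex hull closed, so rounding places grid controls in the convex hull
itself. -/
lemma finite_discretize_dwellSet {N : ℕ} (hN : 0 < N) :
    (discretize N (dwellSet (I.T : ℝ) I.L I.l)).Finite := by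
  have hfin : (Set.univ.pi fun _ : Fin N => ({0, 1} : Set ℝ)).Finite :=
    Set.Finite.pi fun _ => Set.toFinite _
  refine (hfin.image (stepFun (I.T : ℝ) N)).subset ?_
  rintro _ ⟨hu, v, rfl⟩
  refine ⟨v, fun i _ => ?_, rfl⟩
  have hv := hu.1.2
  rw [valuesIn_iff] at hv
  have hN' : (0 : ℝ) < N := Nat.cast_pos.2 hN
  have hT := I.T_pos_real
  have hd : 0 < (I.T : ℝ) / N := by positivity
  have hlt : (i : ℝ) * (I.T / N) < ((i : ℝ) + 1) * (I.T / N) := by linarith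
  have hiT : (i : ℝ) * (I.T / N) < I.T := by
    have : (i : ℝ) < N := by exact_mod_cast i.2
    calc (i : ℝ) * (I.T / N) < N * (I.T / N) := by gcongr
      _ = I.T := by field_simp
  obtain ⟨t, t1, t2, -, t4, t5⟩ := exists_mem_Ioo_of_ae
    (hv.and (rep_stepFun_gridCell I.T_pos_real v)) hlt hiT
  have hti : t ∈ gridCell (I.T : ℝ) N i := ⟨t1, t2⟩
  rw [← t5 i hti]
  exact t4 (gridCell_subset I.T_pos_real i hti).1

/-- Rounding acts on values and so keeps a pair on its grid, and the lift of a grid control can be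
taken on the grid. No relation between the grid and `L, l` is needed here. -/
lemma projFirst_discretizeTuple_ext {N : ℕ} (hN : 0 < N) :
    projFirst (discretizeTuple N I.ext) =
      convexHull ℝ (discretize N (dwellSet (I.T : ℝ) I.L I.l)) := by
  refine Subset.antisymm ?_ (convexHull_min ?_ (convex_projFirst (I.convex_ext.inter ?_)))
  · rintro _ ⟨w, ⟨hw, hstep⟩, rfl⟩
    rw [← ((I.finite_discretize_dwellSet hN).isClosed_convexHull ℝ).closure_eq]
    refine mem_closure_convexHull_of_rounding I.T_pos_real (z := w 1) fun θ hθ => ?_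
    obtain ⟨r, hr, hre⟩ := exists_rounding hw hθ
    refine ⟨r, ⟨hr, ?_⟩, hre⟩
    obtain ⟨v, hv⟩ := hstep 0
    obtain ⟨v', hv'⟩ := hstep 1
    refine mem_stepSpace_of_ae I.T_pos_real hN
      (fun i => (⌊v' i + θ⌋ : ℝ) - ⌊v' i - v i + θ⌋) ?_
    filter_upwards [hre, rep_stepFun_gridCell I.T_pos_real v,
      rep_stepFun_gridCell I.T_pos_real v'] with t h1 h2 h3 i hi
    rw [hv] at h2
    rw [hv'] at h3
    rw [h1, h2 i hi, h3 i hi]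
  · rintro u ⟨hu, hN'⟩
    obtain ⟨w, hw, h0, h1⟩ := exists_mem_ext hu
    refine ⟨w, ⟨hw, fun c => ?_⟩, h0⟩
    fin_cases c
    · change w 0 ∈ _
      rwa [h0]
    · exact h1 N hN hN'
  · intro w hw w' hw' a b ha hb hab c
    exact convex_stepSpace _ N (hw c) (hw' c) ha hb hab

lemma isExtendedFormulation :
    IsExtendedFormulation (dwellSet I.T I.L I.l) I.ext I.system :=
  ⟨I.projFirst_ext, I.ext_eq_solutions⟩

end DwellInput

/-! ### Polynomial-time computability of the discretization -/

namespace DwellInput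

/-- The factor by which grids are refined so that `L` and `l` are multiples of the cell
length. -/
def refinement (I : DwellInput) : ℕ := I.L.den * I.T.num.toNat * I.l.den

/-- The number of grid cells that make up `L`. -/
def cellsL (I : DwellInput) (M : ℕ) : ℕ := I.L.num.toNat * I.T.den * I.l.den * M

/-- The number of grid cells that make up `l`. -/
def cellsl (I : DwellInput) (M : ℕ) : ℕ := I.l.num.toNat * I.T.den * I.L.den * M

variable (I : DwellInput)

lemma T_num_pos : 0 < I.T.num := Rat.num_pos.2 I.T_pos

lemma refinement_pos : 0 < I.refinement := by
  have h1 := I.L.den_pos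
  have h2 := I.l.den_pos
  have h3 := I.T_num_pos
  have h4 : 0 < I.T.num.toNat := by omega
  exact Nat.mul_pos (Nat.mul_pos h1 h4) h2

lemma T_num_cast : ((I.T.num.toNat : ℕ) : ℤ) = I.T.num := Int.toNat_of_nonneg I.T_num_pos.le

lemma L_num_cast : ((I.L.num.toNat : ℕ) : ℤ) = I.L.num :=
  Int.toNat_of_nonneg (Rat.num_nonneg.2 I.L_nonneg)

lemma l_num_cast : ((I.l.num.toNat : ℕ) : ℤ) = I.l.num :=
  Int.toNat_of_nonneg (Rat.num_nonneg.2 I.l_nonneg)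

/-- The numerator of `T` cancels in the cell length, which becomes `1 / (T.den * L.den * l.den *
M)`; both `L` and `l` are integer multiples of this. -/
lemma L_eq_cells {M : ℕ} (hM : 0 < M) :
    (I.L : ℝ) = I.cellsL M * (I.T / ((I.refinement * M : ℕ) : ℝ)) := by
  have h1 : (I.L : ℝ) = (I.L.num.toNat : ℝ) / I.L.den := by
    have : (I.L.num : ℝ) = (I.L.num.toNat : ℝ) := by exact_mod_cast I.L_num_cast.symm
    rw [← this]
    exact Rat.cast_def I.L
  have h2 : (I.T : ℝ) = (I.T.num.toNat : ℝ) / I.T.den := by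
    have : (I.T.num : ℝ) = (I.T.num.toNat : ℝ) := by exact_mod_cast I.T_num_cast.symm
    rw [← this]
    exact Rat.cast_def I.T
  have h3 : (0 : ℝ) < I.T.num.toNat := by
    have := I.T_num_pos
    exact_mod_cast (show 0 < I.T.num.toNat by omega)
  have h4 : (0 : ℝ) < I.T.den := by exact_mod_cast I.T.den_pos
  have h5 : (0 : ℝ) < I.L.den := by exact_mod_cast I.L.den_pos
  have h6 : (0 : ℝ) < I.l.den := by exact_mod_cast I.l.den_pos
  have h7 : (0 : ℝ) < M := by exact_mod_cast hM
  rw [h1, h2]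
  simp only [refinement, cellsL]
  push_cast
  field_simp

lemma l_eq_cells {M : ℕ} (hM : 0 < M) :
    (I.l : ℝ) = I.cellsl M * (I.T / ((I.refinement * M : ℕ) : ℝ)) := by
  have h1 : (I.l : ℝ) = (I.l.num.toNat : ℝ) / I.l.den := by
    have : (I.l.num : ℝ) = (I.l.num.toNat : ℝ) := by exact_mod_cast I.l_num_cast.symm
    rw [← this]
    exact Rat.cast_def I.l
  have h2 : (I.T : ℝ) = (I.T.num.toNat : ℝ) / I.T.den := by
    have : (I.T.num : ℝ) = (I.T.num.toNat : ℝ) := by exact_mod_cast I.T_num_cast.symm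
    rw [← this]
    exact Rat.cast_def I.T
  have h3 : (0 : ℝ) < I.T.num.toNat := by
    have := I.T_num_pos
    exact_mod_cast (show 0 < I.T.num.toNat by omega)
  have h4 : (0 : ℝ) < I.T.den := by exact_mod_cast I.T.den_pos
  have h5 : (0 : ℝ) < I.L.den := by exact_mod_cast I.L.den_pos
  have h6 : (0 : ℝ) < I.l.den := by exact_mod_cast I.l.den_pos
  have h7 : (0 : ℝ) < M := by exact_mod_cast hM
  rw [h1, h2]
  simp only [refinement, cellsl]
  push_cast
  field_simp

/-- The machine divides with rounding down, so the ceiling is written as the negated floor of the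
negated fraction. -/
lemma sigma_eq : I.sigma = -((-(2 * I.T.num * I.L.den * I.l.den)) /
    (I.T.den * (I.L.num * I.l.den + I.l.num * I.L.den))) := by
  have h4 : (0 : ℚ) < I.T.den := by exact_mod_cast I.T.den_pos
  have h5 : (0 : ℚ) < I.L.den := by exact_mod_cast I.L.den_pos
  have h6 : (0 : ℚ) < I.l.den := by exact_mod_cast I.l.den_pos
  have e1 := Rat.num_div_den I.T
  have e2 := Rat.num_div_den I.L
  have e3 := Rat.num_div_den I.l
  have hsum : I.L + I.l = ((I.L.num * I.l.den + I.l.num * I.L.den : ℤ) : ℚ) /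
      (I.L.den * I.l.den) := by
    have h : I.L + I.l = (I.L.num : ℚ) / I.L.den + (I.l.num : ℚ) / I.l.den := by rw [e2, e3]
    rw [h]
    push_cast
    field_simp
  have hpos : 0 < I.L.num * I.l.den + I.l.num * I.L.den := by
    have h := I.add_pos
    rw [hsum, div_pos_iff_of_pos_right (by positivity)] at h
    exact_mod_cast h
  have hq : (0 : ℚ) < ((I.L.num * I.l.den + I.l.num * I.L.den : ℤ) : ℚ) := by exact_mod_cast hpos
  have hDpos : 0 < (I.T.den : ℤ) * (I.L.num * I.l.den + I.l.num * I.L.den) :=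
    mul_pos (by exact_mod_cast I.T.den_pos) hpos
  have hT : I.T = (I.T.num : ℚ) / I.T.den := e1.symm
  have hfrac : 2 * I.T / (I.L + I.l) = -(((-(2 * I.T.num * I.L.den * I.l.den) : ℤ) : ℚ) /
      ((I.T.den * (I.L.num * I.l.den + I.l.num * I.L.den) : ℤ) : ℚ)) := by
    rw [hsum]
    conv_lhs => rw [hT]
    push_cast at hq ⊢
    field_simp
  rw [sigma, hfrac, Int.ceil_neg, Int.floor_div_cast_of_nonneg hDpos.le, Int.floor_intCast]

end DwellInput

/-! ### Table lookup without branching -/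

namespace RAM.Arith

/-- Look up the value of an expression in a table whose entries are numbered from `n` on. -/
def table (x : Arith) : List ℤ → ℕ → Arith
  | [], _ => const 0
  | a :: as, n => add (mul (eqInd x (const n)) (const a)) (table x as (n + 1))

lemma varsBelow_table {m : ℕ} {x : Arith} (hx : x.VarsBelow m) (as : List ℤ) (n : ℕ) :
    (x.table as n).VarsBelow m := by
  induction as generalizing n with
  | nil => trivial
  | cons a as ih => exact ⟨⟨⟨trivial, ⟨⟨hx, trivial⟩, hx, trivial⟩, trivial⟩, trivial⟩, ih _⟩

lemma eval_table_cons (r : ℕ → ℤ) (x : Arith) (a : ℤ) (as : List ℤ) (n : ℕ) :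
    (x.table (a :: as) n).eval r =
      (if x.eval r = n then 1 else 0) * a + (x.table as (n + 1)).eval r :=
  congrArg (· * a + (x.table as (n + 1)).eval r) (eval_eqInd r x (const n))

lemma eval_table_of_lt (r : ℕ → ℤ) {x : Arith} (as : List ℤ) {n : ℕ} (hx : x.eval r < n) :
    (x.table as n).eval r = 0 := by
  induction as generalizing n with
  | nil => rfl
  | cons a as ih =>
    rw [eval_table_cons, ih (by push_cast; omega), if_neg hx.ne]
    simp

lemma eval_table_add (r : ℕ → ℤ) {x : Arith} (as : List ℤ) {n k : ℕ}
    (hx : x.eval r = (n + k : ℕ)) : (x.table as n).eval r = as.getD k 0 := by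
  induction as generalizing n k with
  | nil => rfl
  | cons a as ih =>
    rw [eval_table_cons]
    cases k with
    | zero =>
      rw [eval_table_of_lt r as (by rw [hx]; push_cast; omega), if_pos (by simpa using hx)]
      simp
    | succ k =>
      rw [ih (k := k) (by rw [hx]; push_cast; ring), if_neg (by rw [hx]; push_cast; omega)]
      simp

lemma eval_table (r : ℕ → ℤ) {x : Arith} (as : List ℤ) {k : ℕ} (hx : x.eval r = k) :
    (x.table as 0).eval r = as.getD k 0 :=
  eval_table_add r as (by simpa using hx)

end RAM.Arith

namespace DwellInput

open RAM RAM.Arith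

lemma ratCode_intCast (x : ℤ) : ratCode (x : ℚ) = [x, 1] := by simp [ratCode]

lemma refinement_cast (I : DwellInput) :
    ((I.refinement : ℕ) : ℤ) = I.L.den * I.T.num * I.l.den := by
  rw [refinement]
  push_cast
  rw [T_num_cast]

/-- The refinement factor, computed from `M, T, L, l`. -/
def refinementArith : Arith := mul (mul (var 5) (var 2)) (var 7)

lemma polyTime_refinement :
    PolyTime (fun g : GridQuery dwellClass => (g.M : ℤ) :: dwellClass.enc g.I)
      (fun g => [((refinement g.I : ℕ) : ℤ)]) := by
  -- Register `0` holds the length `7`; `M` is in register `1`, and numerator and denominator of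
  -- `T`, `L`, `l` are in registers `2, 3`, then `4, 5`, then `6, 7`.
  refine polyTime_arith 7 refinementArith (fun q => rfl) ?_ fun q => ?_
  · simp [refinementArith, VarsBelow]
  · have h : ((refinement q.I : ℕ) : ℤ) =
        refinementArith.eval (start ((q.M : ℤ) :: dwellClass.enc q.I)).reg := refinement_cast q.I
    rw [h]
    exact ⟨[1], rfl⟩

/-- The program is given `N` but neither `M` nor the number of cells in `L`. The left-hand side is
`(i - j) T / N = L` with denominators cleared. -/
lemma eq_add_cellsL_iff (I : DwellInput) (M i j : ℕ) :
    ((i : ℤ) - j) * (I.L.den * I.T.num) = I.L.num * I.T.den * ((I.refinement * M : ℕ) : ℤ) ↔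
      i = j + I.cellsL M := by
  have h1 : (0 : ℤ) < I.L.den * I.T.num :=
    mul_pos (by exact_mod_cast I.L.den_pos) I.T_num_pos
  have e : I.L.num * I.T.den * ((I.refinement * M : ℕ) : ℤ) =
      (I.cellsL M : ℤ) * (I.L.den * I.T.num) := by
    simp only [refinement, cellsL]
    push_cast
    rw [T_num_cast, L_num_cast]
    ring
  rw [e, mul_left_inj' h1.ne']
  omega

lemma eq_add_cellsl_iff (I : DwellInput) (M i j : ℕ) :
    ((i : ℤ) - j) * (I.l.den * I.T.num) = I.l.num * I.T.den * ((I.refinement * M : ℕ) : ℤ) ↔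
      i = j + I.cellsl M := by
  have h1 : (0 : ℤ) < I.l.den * I.T.num :=
    mul_pos (by exact_mod_cast I.l.den_pos) I.T_num_pos
  have e : I.l.num * I.T.den * ((I.refinement * M : ℕ) : ℤ) =
      (I.cellsl M : ℤ) * (I.l.den * I.T.num) := by
    simp only [refinement, cellsl]
    push_cast
    rw [T_num_cast, l_num_cast]
    ring
  rw [e, mul_left_inj' h1.ne']
  omega

/-- The coefficients of the variables, computed from `N, k, i, c, j, T, L, l`. -/
def coeffArith : Arith :=
  let same := eqInd (var 3) (var 5)
  let atL := eqInd (mul (sub (var 3) (var 5)) (mul (var 9) (var 6)))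
    (mul (mul (var 8) (var 7)) (var 1))
  let atl := eqInd (mul (sub (var 3) (var 5)) (mul (var 11) (var 6)))
    (mul (mul (var 10) (var 7)) (var 1))
  let first := eqInd (var 4) (const 0)
  add
    (mul first (add (mul (table (var 2) [1, -1, 0, 0, 1, 0, -1, 0] 0) same)
      (mul (table (var 2) [0, 0, 0, 0, 0, -1, 0, 0] 0) atl)))
    (mul (sub (const 1) first) (add (add
      (mul (table (var 2) [0, 0, 1, -1, -1, -1, 1, 1] 0) same)
      (mul (table (var 2) [0, 0, 0, 0, 1, 0, 0, 0] 0) atL))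
      (mul (table (var 2) [0, 0, 0, 0, 0, 1, 0, 0] 0) atl)))

/-- The constant terms, computed from `N, k, i, T, L, l`. -/
def constArith : Arith :=
  add (table (var 2) [0, 1, 0, 0, 0, 1, 0, 0] 0)
    (mul (eqInd (var 2) (const 3)) (sub (const 0)
      (div (sub (const 0) (mul (mul (mul (const 2) (var 4)) (var 7)) (var 9)))
        (mul (var 5) (add (mul (var 6) (var 9)) (mul (var 8) (var 7)))))))

lemma varsBelow_coeffArith : coeffArith.VarsBelow 12 := by
  have ht : ∀ as, ((var 2).table as 0).VarsBelow 12 := fun as =>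
    varsBelow_table (x := var 2) (show (2 : ℕ) < 12 by norm_num) as 0
  simp [coeffArith, VarsBelow, eqInd, ht]

lemma varsBelow_constArith : constArith.VarsBelow 10 := by
  have ht : ∀ as, ((var 2).table as 0).VarsBelow 10 := fun as =>
    varsBelow_table (x := var 2) (show (2 : ℕ) < 10 by norm_num) as 0
  simp [constArith, VarsBelow, eqInd, ht]

lemma eval_coeffArith (I : DwellInput) (M : ℕ) (k : Fin 8) (i c j : ℕ) (r : ℕ → ℤ)
    (h1 : r 1 = ((I.refinement * M : ℕ) : ℤ)) (h2 : r 2 = (k : ℕ)) (h3 : r 3 = i) (h4 : r 4 = c)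
    (h5 : r 5 = j) (h6 : r 6 = I.T.num) (h7 : r 7 = I.T.den) (h8 : r 8 = I.L.num)
    (h9 : r 9 = I.L.den) (h10 : r 10 = I.l.num) (h11 : r 11 = I.l.den) :
    coeffArith.eval r = (I.coeffs k).coeff (I.cellsL M) (I.cellsl M) i c j := by
  have ht : ∀ as : List ℤ, ((var 2).table as 0).eval r = as.getD k 0 := fun as =>
    eval_table r as h2
  simp only [coeffArith, eval, eval_eqInd, ht, h1, h3, h4, h5, h6, h7, h8, h9, h10, h11,
    eq_add_cellsL_iff, eq_add_cellsl_iff, Nat.cast_inj, Nat.cast_eq_zero, ShiftCoeffs.coeff]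
  have e1 : ([1, -1, 0, 0, 1, 0, -1, 0] : List ℤ).getD k 0 = (I.coeffs k).u := by
    fin_cases k <;> rfl
  have e2 : ([0, 0, 0, 0, 0, -1, 0, 0] : List ℤ).getD k 0 = (I.coeffs k).ul := by
    fin_cases k <;> rfl
  have e3 : ([0, 0, 1, -1, -1, -1, 1, 1] : List ℤ).getD k 0 = (I.coeffs k).z := by
    fin_cases k <;> rfl
  have e4 : ([0, 0, 0, 0, 1, 0, 0, 0] : List ℤ).getD k 0 = (I.coeffs k).zL := by
    fin_cases k <;> rfl
  have e5 : ([0, 0, 0, 0, 0, 1, 0, 0] : List ℤ).getD k 0 = (I.coeffs k).zl := by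
    fin_cases k <;> rfl
  rw [e1, e2, e3, e4, e5]
  by_cases hc : c = 0
  · simp only [hc, if_true]
    ring
  · simp only [hc, if_false]
    ring

lemma eval_constArith (I : DwellInput) (k : Fin 8) (r : ℕ → ℤ) (h2 : r 2 = (k : ℕ))
    (h4 : r 4 = I.T.num) (h5 : r 5 = I.T.den) (h6 : r 6 = I.L.num) (h7 : r 7 = I.L.den)
    (h8 : r 8 = I.l.num) (h9 : r 9 = I.l.den) :
    constArith.eval r = (I.coeffs k).one := by
  have ht : ∀ as : List ℤ, ((var 2).table as 0).eval r = as.getD k 0 := fun as =>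
    eval_table r as h2
  simp only [constArith, eval, eval_eqInd, ht, h2, h4, h5, h6, h7, h8, h9, zero_sub]
  rw [← sigma_eq]
  fin_cases k <;> simp [coeffs]

lemma isWeaklyCompatible :
    IsWeaklyCompatible dwellClass (fun _ => 1) DwellInput.ext DwellInput.system := by
  have hN : ∀ g : GridQuery dwellClass, 0 < refinement g.I * g.M := fun g =>
    Nat.mul_pos (refinement_pos g.I) g.hM
  have hcoeff : ∀ (g : GridQuery dwellClass) (k : Fin 8),
      HasCoefficients (constraint g.I k).op (refinement g.I * g.M)
        (fun i c j => (((coeffs g.I k).coeff (cellsL g.I g.M) (cellsl g.I g.M) i c j : ℤ) : ℝ))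
        fun _ => ((coeffs g.I k).one : ℝ) := fun g k =>
    ShiftCoeffs.hasCoefficients (T_pos_real g.I) _ _ _ (hN g) (L_eq_cells g.I g.hM)
      (l_eq_cells g.I g.hM)
  -- The refinement factor does not depend on `M`, so a constant polynomial bounds it for each
  -- input.
  refine ⟨fun g => refinement g.I, polyTime_refinement, fun I =>
    ⟨Polynomial.C (refinement I), fun M _ => by simp⟩, fun g => refinement_pos g.I,
    fun g => projFirst_discretizeTuple_ext g.I (hN g), fun g k w hw => ?_,
    fun e => (((coeffs e.row.g.I e.row.k).coeff (cellsL e.row.g.I e.row.g.M)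
      (cellsl e.row.g.I e.row.g.M) e.row.i e.c e.j : ℤ) : ℚ),
    fun q => (((coeffs q.g.I q.k).one : ℤ) : ℚ), fun g k => ?_, ?_, ?_⟩
  · choose v hv using hw
    obtain rfl : (fun c => stepFun _ _ (v c)) = w := funext hv
    exact ⟨_, (hcoeff g k v).symm⟩
  · have h := hcoeff g k
    simp only [Rat.cast_intCast]
    exact h
  · refine polyTime_arith 11 coeffArith (fun q => rfl) varsBelow_coeffArith fun q => ?_
    rw [ratCode_intCast, eval_coeffArith q.row.g.I q.row.g.M q.row.k q.row.i q.c q.j] <;> rfl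
  · refine polyTime_arith 9 constArith (fun q => rfl) varsBelow_constArith fun q => ?_
    rw [ratCode_intCast, eval_constArith q.g.I q.k] <;> rfl

lemma isSmall : IsSmall dwellClass (fun _ => 1) DwellInput.system :=
  ⟨8, fun _ => ⟨by simp, by simp [system]⟩⟩

end DwellInput

theorem mainTheorem4 :
    ∃ A : ∀ I : DwellInput, LinSystem (I.T : ℝ) 1,
      (∀ I : DwellInput, IsExtendedFormulation (dwellSet I.T I.L I.l) I.ext (A I)) ∧
      IsSmall dwellClass (fun _ => 1) A ∧
      IsWeaklyCompatible dwellClass (fun _ => 1) DwellInput.ext A := by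
  exact ⟨DwellInput.system, DwellInput.isExtendedFormulation, DwellInput.isSmall,
    DwellInput.isWeaklyCompatible⟩
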